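/- Let $K$ be any field and let $G$ be a finite simple graph with vertex set $V$. Let $I(G)$ be its edge ideal, i.e. the ideal of $K[V]$ (the polynomial ring whose indeterminates are the vertices of $G$) generated by the products $xy$ over all edges $\{x,y\}$ of $G$. For an ideal $I$ of $K[V]$, let $\operatorname{ara} I$ (the arithmetical rank) be the minimum number of elements of $K[V]$ generating an ideal with the same radical as $I$, and let $\operatorname{bight} I$ (the big height) be the maximum height of the minimal primes of $I$. Suppose that $G$ is a cactus graph, i.e. any two distinct cycles of $G$ have at most one vertex in common. Let $n$ be the number of cycles of $G$ (cycles being counted as subgraphs), and let $k$ be the number of those cycles whose length is divisible by $3$ and all of whose vertices, except possibly two consecutive ones, have degree $2$ in $G$. Then $$\operatorname{ara} I(G)\le \operatorname{bight} I(G)+n-k.$$ -/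

import Mathlib

namespace CactusGraph

section Algebra

variable {R : Type*} [CommRing R]

/-- The arithmetical rank of an ideal: the minimum number of ring elements that generate an ideal
with the same radical (`⊤` if no finite set of elements does). -/
noncomputable def ara (I : Ideal R) : ℕ∞ :=
  ⨅ (s : Finset R) (_ : (Ideal.span (s : Set R)).radical = I.radical), (s.card : ℕ∞)

/-- The big height of an ideal: the maximum height of its minimal primes. -/
noncomputable def bight (I : Ideal R) : ℕ∞ :=
  ⨆ p ∈ I.minimalPrimes, p.height

end Algebra

section Graph

variable {V : Type*}

/-- The edge ideal of `G` in the polynomial ring over `K` whose indeterminates are the vertices: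
it is generated by the products `x y` over the edges `{x, y}` of `G`. -/
noncomputable def edgeIdeal (K : Type*) [Field K] (G : SimpleGraph V) : Ideal (MvPolynomial V K) :=
  Ideal.span {f | ∃ x y : V, G.Adj x y ∧ f = MvPolynomial.X x * MvPolynomial.X y}

/-- A subgraph of `G` is a cycle if it is traced out by a closed walk that is a cycle. Cycles are
taken as subgraphs, so the starting point and the orientation of the walk do not matter. -/
def IsCycleSubgraph (G : SimpleGraph V) (C : G.Subgraph) : Prop :=
  ∃ (v : V) (p : G.Walk v v), p.IsCycle ∧ p.toSubgraph = C

/-- A cactus graph: any two distinct cycles have at most one vertex in common. -/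
def IsCactus (G : SimpleGraph V) : Prop :=
  ∀ C D : G.Subgraph, IsCycleSubgraph G C → IsCycleSubgraph G D → C ≠ D →
    (C.verts ∩ D.verts).Subsingleton

/-- A cycle of `G` whose length is divisible by `3` and all of whose vertices, with the possible
exception of two consecutive ones `a` and `b`, have degree `2` in `G`. -/
def IsSpecialCycle (G : SimpleGraph V) [G.LocallyFinite] (C : G.Subgraph) : Prop :=
  (∃ (v : V) (p : G.Walk v v), p.IsCycle ∧ p.toSubgraph = C ∧ 3 ∣ p.length) ∧
    ∃ a b : V, C.Adj a b ∧ ∀ w ∈ C.verts, w ≠ a → w ≠ b → G.degree w = 2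

end Graph

end CactusGraph

/-! Let `dom G` be the largest size of N(A) over independent sets A. If B is a maximal independent
set containing A, its complement is a minimal vertex cover containing N(A), and the variables of
this cover generate a minimal prime; hence `dom_le_bight`. So it suffices to generate the edge ideal
up to radical by `dom G + ordinaryCount G` elements, the second summand counting the cycles that are
not special.

This is an induction on the number of edges (`cutBy_of_forall_reducible`). Delete a set L of edges
of which an independent set of G - L contains at most t. The variables outside a prime containing
I(G - L) form such an independent set, so t elementary symmetric polynomials in the monomials of L
recover L (`CutBy.of_deleteEdges`). Either `dom` must drop by t, or t = 1, an ordinary cycle is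
destroyed and `dom` must not grow.

It remains to reduce every cactus with an edge (`EdgeCactus.reducible`). Special cycles of length at
least 6 are treated by `IsThread.reducible`; otherwise special cycles are triangles. Fix a maximal
independent set of vertices with clique neighbourhoods, the caps, and call a vertex bare if it is
neither a cap nor adjacent to one. Special triangles contain a cap and no bare vertex. If nothing is
bare, the whole graph is a cluster. Otherwise choose a bare z with all other bare vertices of its
component on one side. If z lies on a cycle, that cycle is ordinary and loses an edge at z. If not,
z is joined by a bridge to a cluster. By `IsCluster.reducible_or` a cluster can be reduced or is a
star, and stars are reducible too. -/

namespace CactusGraph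

open Finset
open scoped Classical

/-! ### Independent sets and their neighbourhoods -/

section Domination

variable {V : Type*}

/-- A finite set of vertices without edges. -/
def Indep (G : SimpleGraph V) (A : Finset V) : Prop :=
  ∀ a ∈ A, ∀ b ∈ A, ¬ G.Adj a b

lemma indep_empty {G : SimpleGraph V} : Indep G ∅ := by simp [Indep]

lemma Indep.subset {G : SimpleGraph V} {A B : Finset V} (h : Indep G A) (hB : B ⊆ A) :
    Indep G B :=
  fun a ha b hb => h a (hB ha) b (hB hb)

variable [Fintype V]

/-- The open neighbourhood of a set of vertices. -/
noncomputable def nbrs (G : SimpleGraph V) (A : Finset V) : Finset V :=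
  univ.filter fun v => ∃ a ∈ A, G.Adj a v

/-- The largest size of the open neighbourhood of an independent set. -/
noncomputable def dom (G : SimpleGraph V) : ℕ :=
  (univ.filter fun A : Finset V => Indep G A).sup fun A => (nbrs G A).card

variable {G : SimpleGraph V} {A : Finset V} {v : V}

lemma mem_nbrs : v ∈ nbrs G A ↔ ∃ a ∈ A, G.Adj a v := by simp [nbrs]

lemma card_nbrs_le_dom (h : Indep G A) : (nbrs G A).card ≤ dom G :=
  Finset.le_sup (f := fun A => (nbrs G A).card) (by simpa using h)

variable (G) in
lemma exists_card_nbrs_eq_dom : ∃ A, Indep G A ∧ (nbrs G A).card = dom G := by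
  obtain ⟨A, hA, h⟩ := Finset.exists_mem_eq_sup
    (univ.filter fun A : Finset V => Indep G A) ⟨∅, by simp [indep_empty]⟩
    fun A => (nbrs G A).card
  exact ⟨A, by simpa using hA, h.symm⟩

lemma Indep.notMem_of_mem_nbrs (h : Indep G A) (hv : v ∈ nbrs G A) : v ∉ A := by
  intro hvA
  obtain ⟨a, ha, hav⟩ := mem_nbrs.1 hv
  exact h a ha v hvA hav

lemma dom_add_le {H : SimpleGraph V} {t : ℕ}
    (h : ∀ A, Indep H A → ∃ B, Indep G B ∧ (nbrs H A).card + t ≤ (nbrs G B).card) :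
    dom H + t ≤ dom G := by
  obtain ⟨A, hA, hA'⟩ := exists_card_nbrs_eq_dom H
  obtain ⟨B, hB, hB'⟩ := h A hA
  have := card_nbrs_le_dom hB
  omega

/-- Every independent set extends to one that dominates all remaining vertices. -/
lemma Indep.exists_maximal (h : Indep G A) :
    ∃ B, A ⊆ B ∧ Indep G B ∧ ∀ v ∉ B, v ∈ nbrs G B := by
  obtain ⟨B, hB, hmax⟩ := Finset.exists_max_image
    (univ.filter fun B : Finset V => A ⊆ B ∧ Indep G B) Finset.card ⟨A, by simp [h]⟩
  simp only [mem_filter, mem_univ, true_and] at hB hmax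
  refine ⟨B, hB.1, hB.2, fun v hv => ?_⟩
  by_contra hn
  have hn' : ∀ a ∈ B, ¬ G.Adj a v := fun a ha hav => hn (mem_nbrs.2 ⟨a, ha, hav⟩)
  have := hmax (insert v B) ⟨hB.1.trans (subset_insert _ _), by
    intro a ha b hb hab
    rcases mem_insert.1 ha with rfl | haB <;> rcases mem_insert.1 hb with rfl | hbB
    · exact G.loopless.irrefl _ hab
    · exact hn' b hbB hab.symm
    · exact hn' a haB hab
    · exact hB.2 a haB b hbB hab⟩
  rw [card_insert_of_notMem hv] at this
  omega

end Domination

/-! ### Cycles as edge sets, and their behaviour under edge deletion -/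

section Cycles

variable {V : Type*}

/-- The edge sets of the cycles of a graph. -/
def CycleEdges (G : SimpleGraph V) (E : Set (Sym2 V)) : Prop :=
  ∃ (v : V) (p : G.Walk v v), p.IsCycle ∧ p.edgeSet = E

/-- The edge sets of the special cycles of a graph. -/
def SpecialEdges (G : SimpleGraph V) (E : Set (Sym2 V)) : Prop :=
  ∃ (v : V) (p : G.Walk v v), p.IsCycle ∧ p.edgeSet = E ∧ 3 ∣ p.length ∧
    ∃ a b : V, s(a, b) ∈ E ∧ ∀ w ∈ p.support, w ≠ a → w ≠ b → (G.neighborSet w).ncard = 2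

/-- Two cycles with different edge sets have at most one common vertex. -/
def EdgeCactus (G : SimpleGraph V) : Prop :=
  ∀ ⦃v w : V⦄ (p : G.Walk v v) (q : G.Walk w w), p.IsCycle → q.IsCycle → p.edgeSet ≠ q.edgeSet →
    ∀ a b, a ∈ p.support → b ∈ p.support → a ∈ q.support → b ∈ q.support → a = b

/-- The number of cycles that are not special. -/
noncomputable def ordinaryCount (G : SimpleGraph V) : ℕ :=
  {E | CycleEdges G E ∧ ¬ SpecialEdges G E}.ncard

variable {G H : SimpleGraph V} {E : Set (Sym2 V)}

lemma EdgeCactus.mono (hG : EdgeCactus G) (h : H ≤ G) : EdgeCactus H := by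
  intro v w p q hp hq hpq a b ha hb ha' hb'
  refine hG (p.mapLe h) (q.mapLe h) (hp.mapLe h) (hq.mapLe h) ?_ a b ?_ ?_ ?_ ?_
  · intro he
    apply hpq
    ext e
    have := Set.ext_iff.1 he e
    simpa [SimpleGraph.Walk.edgeSet] using this
  all_goals simpa

lemma CycleEdges.mono (hE : CycleEdges H E) (h : H ≤ G) : CycleEdges G E := by
  obtain ⟨v, p, hp, rfl⟩ := hE
  exact ⟨v, p.mapLe h, hp.mapLe h, by ext e; simp [SimpleGraph.Walk.edgeSet]⟩

lemma CycleEdges.subset (hE : CycleEdges G E) : E ⊆ G.edgeSet := by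
  obtain ⟨v, p, hp, rfl⟩ := hE
  exact fun e he => p.edges_subset_edgeSet he

lemma mem_support_iff_of_isCycle {v : V} {p : G.Walk v v} (hp : p.IsCycle) (w : V) :
    w ∈ p.support ↔ ∃ e ∈ p.edgeSet, w ∈ e := by
  rw [SimpleGraph.Walk.mem_support_iff_exists_mem_edges_of_not_nil hp.not_nil]
  rfl

lemma two_le_ncard_neighborSet [Finite V] {v w : V} {p : G.Walk v v} (hp : p.IsCycle)
    (hw : w ∈ p.support) : 2 ≤ (G.neighborSet w).ncard := by
  have h := hp.ncard_neighborSet_toSubgraph_eq_two hw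
  rw [← h]
  exact Set.ncard_le_ncard (p.toSubgraph.neighborSet_subset w) (Set.toFinite _)

/-- Degrees can only fall in a subgraph, but stay at least 2 on a cycle. Thus deleting edges never
turns a special cycle into an ordinary one. -/
lemma SpecialEdges.of_le [Finite V] (hE : SpecialEdges G E) (hH : CycleEdges H E) (h : H ≤ G) :
    SpecialEdges H E := by
  obtain ⟨v, p, hp, rfl, h3, a, b, hab, hdeg⟩ := hE
  have hpe : ∀ e ∈ p.edges, e ∈ H.edgeSet := fun e he => hH.subset he
  refine ⟨v, p.transfer H hpe, hp.transfer hpe, ?_, by simpa, a, b, hab, ?_⟩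
  · ext e; simp [SimpleGraph.Walk.edgeSet]
  · intro w hw hwa hwb
    refine le_antisymm ?_ (two_le_ncard_neighborSet (hp.transfer hpe) hw)
    rw [← hdeg w (by simpa using hw) hwa hwb]
    exact Set.ncard_le_ncard (fun y hy => h hy) (Set.toFinite _)

lemma ordinaryCount_mono [Finite V] (h : H ≤ G) : ordinaryCount H ≤ ordinaryCount G :=
  Set.ncard_le_ncard (fun _ hE => ⟨hE.1.mono h, fun hs => hE.2 (hs.of_le hE.1 h)⟩) (Set.toFinite _)

lemma ordinaryCount_lt [Finite V] (h : H ≤ G) {e : Sym2 V} (he : e ∉ H.edgeSet)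
    (hE : CycleEdges G E) (hs : ¬ SpecialEdges G E) (heE : e ∈ E) :
    ordinaryCount H < ordinaryCount G := by
  refine Set.ncard_lt_ncard ⟨fun _ hE => ⟨hE.1.mono h, fun hs => hE.2 (hs.of_le hE.1 h)⟩, ?_⟩
    (Set.toFinite _)
  intro hsub
  exact he ((hsub ⟨hE, hs⟩ : _ ∧ _).1.subset heE)

end Cycles

/-! ### The reduction step -/

section Reducible

variable {V : Type*} [Fintype V]

/-- Some edges can be removed at a cost covered by the decrease of the bound. -/
def Reducible (G : SimpleGraph V) : Prop :=
  ∃ (L : Finset (Sym2 V)) (t : ℕ), L.Nonempty ∧ (L : Set (Sym2 V)) ⊆ G.edgeSet ∧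
    (∀ U, Indep (G.deleteEdges L) U → (L.filter fun e => ∀ v ∈ e, v ∈ U).card ≤ t) ∧
    dom (G.deleteEdges L) + ordinaryCount (G.deleteEdges L) + t ≤ dom G + ordinaryCount G

variable {G : SimpleGraph V}

/-- This makes the drop of `dom` an exchange problem: `A` may contain both ends of a deleted edge
and has to be repaired while gaining `t` neighbours. -/
lemma reducible_of_dom {L : Finset (Sym2 V)} {t : ℕ} (hL : L.Nonempty)
    (hLG : (L : Set (Sym2 V)) ⊆ G.edgeSet)
    (ht : ∀ U, Indep (G.deleteEdges L) U → (L.filter fun e => ∀ v ∈ e, v ∈ U).card ≤ t)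
    (h : ∀ A, Indep (G.deleteEdges L) A →
      ∃ B, Indep G B ∧ (nbrs (G.deleteEdges L) A).card + t ≤ (nbrs G B).card) :
    Reducible G := by
  refine ⟨L, t, hL, hLG, ht, ?_⟩
  have h1 := dom_add_le h
  have h2 := ordinaryCount_mono (G.deleteEdges_le (L : Set (Sym2 V)))
  omega

/-- The lost ordinary cycle pays for the one extra generator. -/
lemma reducible_of_cycle_edge {e : Sym2 V} {E : Set (Sym2 V)} (hE : CycleEdges G E)
    (hs : ¬ SpecialEdges G E) (heE : e ∈ E)
    (h : ∀ A, Indep (G.deleteEdges {e}) A →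
      ∃ B, Indep G B ∧ (nbrs (G.deleteEdges {e}) A).card ≤ (nbrs G B).card) :
    Reducible G := by
  refine ⟨{e}, 1, singleton_nonempty e, by simpa using hE.subset heE, fun U _ => ?_, ?_⟩
  · exact (card_filter_le _ _).trans (by simp)
  have h1 := dom_add_le (t := 0) h
  have h2 := ordinaryCount_lt (G.deleteEdges_le {e}) (e := e) (by simp) hE hs heE
  rw [coe_singleton]
  omega

/-- Two edges that are joined by a third one can be removed together. -/
lemma card_filter_pair_le {H : SimpleGraph V} {U : Finset V} (hU : Indep H U) {e f : Sym2 V}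
    {a b : V} (ha : a ∈ e) (hb : b ∈ f) (hab : H.Adj a b) :
    (({e, f} : Finset (Sym2 V)).filter fun e => ∀ v ∈ e, v ∈ U).card ≤ 1 := by
  rw [card_le_one]
  intro x hx y hy
  simp only [mem_filter, mem_insert, mem_singleton] at hx hy
  obtain ⟨rfl | rfl, hx⟩ := hx <;> obtain ⟨rfl | rfl, hy⟩ := hy
  · rfl
  · exact (hU _ (hx _ ha) _ (hy _ hb) hab).elim
  · exact (hU _ (hy _ ha) _ (hx _ hb) hab).elim
  · rfl

end Reducible

/-! ### Elementary symmetric polynomials and generation up to radical -/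

section Radical

variable {R : Type*} [CommRing R] {σ : Type*}

/-- If at most `t` members of a finite family avoid a prime containing the elementary symmetric
polynomials `e₁, …, e_t` of the family, then the prime contains the whole family. -/
lemma mem_of_esymm_mem {P : Ideal R} [hP : P.IsPrime] (s : Finset σ) (f : σ → R) {t : ℕ}
    (hcard : (s.filter fun i => f i ∉ P).card ≤ t)
    (h : ∀ j, 1 ≤ j → j ≤ t → ∑ u ∈ s.powersetCard j, ∏ i ∈ u, f i ∈ P) :
    ∀ i ∈ s, f i ∈ P := by
  set T := s.filter fun i => f i ∉ P with hT
  by_contra! hne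
  obtain ⟨i, hi, hiP⟩ := hne
  have hpos : 1 ≤ T.card := card_pos.2 ⟨i, by simp [hT, hi, hiP]⟩
  have hTs : T ∈ s.powersetCard T.card := mem_powersetCard.2 ⟨filter_subset _ _, rfl⟩
  -- In degree `T.card`, every term except the product over `T` has a factor in `P`.
  have h1 := h T.card hpos hcard
  rw [← Finset.add_sum_erase _ _ hTs] at h1
  have h2 : ∑ u ∈ (s.powersetCard T.card).erase T, ∏ i ∈ u, f i ∈ P := by
    refine P.sum_mem fun u hu => ?_
    obtain ⟨huT, hu⟩ := mem_erase.1 hu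
    obtain ⟨hus, huc⟩ := mem_powersetCard.1 hu
    have : ∃ i ∈ u, i ∉ T := by
      by_contra! hsub
      exact huT (eq_of_subset_of_card_le hsub huc.ge)
    obtain ⟨j, hju, hjT⟩ := this
    have hj : f j ∈ P := by
      by_contra hjP
      exact hjT (by simp [hT, hus hju, hjP])
    exact P.mem_of_dvd (dvd_prod_of_mem f hju) hj
  have h3 := (Ideal.add_mem_iff_left P h2).1 h1
  obtain ⟨j, hj, hjP⟩ := (hP.prod_mem_iff).1 h3
  exact (mem_filter.1 hj).2 hjP

lemma le_radical_of_forall_prime {I J : Ideal R}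
    (h : ∀ P : Ideal R, P.IsPrime → J ≤ P → I ≤ P) : I ≤ J.radical := by
  rw [Ideal.radical_eq_sInf]
  exact le_sInf fun P hP => h P hP.2 hP.1

/-- The ideal is generated up to radical by `r` elements. -/
def CutBy (I : Ideal R) (r : ℕ) : Prop :=
  ∃ s : Finset R, s.card ≤ r ∧ (Ideal.span (s : Set R)).radical = I.radical

lemma CutBy.ara_le {I : Ideal R} {r : ℕ} (h : CutBy I r) : ara I ≤ r := by
  obtain ⟨s, hs, h⟩ := h
  exact (iInf₂_le s h).trans (by exact_mod_cast hs)

lemma CutBy.mono {I : Ideal R} {r t : ℕ} (h : CutBy I r) (hrt : r ≤ t) : CutBy I t := by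
  obtain ⟨s, hs, h⟩ := h
  exact ⟨s, hs.trans hrt, h⟩

end Radical

/-! ### Edge ideals, cover ideals and the induction on edges -/

section EdgeIdeal

variable (K : Type*) [Field K] {V : Type*}

open MvPolynomial

/-- The monomial of an edge. -/
noncomputable def edgeMonomial (e : Sym2 V) : MvPolynomial V K :=
  e.lift ⟨fun x y => X x * X y, fun _ _ => mul_comm _ _⟩

variable {K} {G : SimpleGraph V}

lemma edgeMonomial_mem {e : Sym2 V} (he : e ∈ G.edgeSet) :
    edgeMonomial K e ∈ edgeIdeal K G := by
  induction e with
  | _ x y => exact Ideal.subset_span ⟨x, y, he, rfl⟩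

lemma edgeIdeal_le_iff {J : Ideal (MvPolynomial V K)} :
    edgeIdeal K G ≤ J ↔ ∀ e ∈ G.edgeSet, edgeMonomial K e ∈ J := by
  refine ⟨fun h e he => h (edgeMonomial_mem he), fun h => Ideal.span_le.2 ?_⟩
  rintro _ ⟨x, y, hxy, rfl⟩
  exact h s(x, y) hxy

lemma edgeMonomial_notMem {P : Ideal (MvPolynomial V K)} {e : Sym2 V}
    (he : edgeMonomial K e ∉ P) : ∀ v ∈ e, (X v : MvPolynomial V K) ∉ P := by
  induction e with
  | _ x y =>
    intro v hv hvP
    apply he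
    rcases Sym2.mem_iff.1 hv with rfl | rfl
    · exact P.mul_mem_right _ hvP
    · exact P.mul_mem_left _ hvP

lemma CutBy.of_edgeSet_eq_empty (h : G.edgeSet = ∅) : CutBy (edgeIdeal K G) 0 := by
  refine ⟨∅, by simp, ?_⟩
  have : edgeIdeal K G ≤ ⊥ := edgeIdeal_le_iff.2 fun e he => by simp [h] at he
  rw [le_bot_iff.1 this]
  simp

/-- The ideal generated by the variables in `C`. -/
noncomputable def coverIdeal (K : Type*) [Field K] (C : Finset V) : Ideal (MvPolynomial V K) :=
  RingHom.ker (aeval fun v => if v ∈ C then 0 else X v :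
    MvPolynomial V K →ₐ[K] MvPolynomial V K)

instance (C : Finset V) : (coverIdeal K C).IsPrime := RingHom.ker_isPrime _

lemma X_mem_coverIdeal {C : Finset V} {v : V} :
    (X v : MvPolynomial V K) ∈ coverIdeal K C ↔ v ∈ C := by
  simp [coverIdeal, RingHom.mem_ker]

/-- As a kernel the ideal is visibly prime; that the variables generate it is recovered here. If
they vanish modulo `J`, the quotient map factors through setting them to zero. -/
lemma coverIdeal_le {C : Finset V} {J : Ideal (MvPolynomial V K)}
    (h : ∀ v ∈ C, (X v : MvPolynomial V K) ∈ J) : coverIdeal K C ≤ J := by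
  intro f hf
  have key : (Ideal.Quotient.mkₐ K J).comp (aeval fun v => if v ∈ C then 0 else X v) =
      Ideal.Quotient.mkₐ K J := by
    ext v
    by_cases hv : v ∈ C
    · simpa [hv] using (Ideal.Quotient.eq_zero_iff_mem.2 (h v hv)).symm
    · simp [hv]
  have hf' : aeval (fun v => if v ∈ C then 0 else X v : V → MvPolynomial V K) f = 0 := hf
  have := DFunLike.congr_fun key f
  rw [AlgHom.comp_apply, hf', map_zero] at this
  exact Ideal.Quotient.eq_zero_iff_mem.1 this.symm

/-- Adjoining the variables one at a time gives a strict chain of primes. -/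
lemma card_le_height_coverIdeal (C : Finset V) : (C.card : ℕ∞) ≤ (coverIdeal K C).height := by
  induction C using Finset.induction_on with
  | empty => simp
  | insert v C hv ih =>
    have hlt : coverIdeal K C < coverIdeal K (insert v C) := by
      refine lt_of_le_of_ne (coverIdeal_le fun w hw => X_mem_coverIdeal.2 (mem_insert_of_mem hw)) ?_
      intro he
      apply hv
      rw [← X_mem_coverIdeal (K := K), he, X_mem_coverIdeal]
      exact mem_insert_self _ _
    have := Ideal.height_add_one_le_of_lt_of_isPrime hlt
    rw [card_insert_of_notMem hv]
    push_cast
    exact (add_le_add_left ih 1).trans this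

variable [Fintype V]

/-- Adding the edges of `L` costs at most `t` elements if no independent set contains more than
`t` of them. -/
lemma CutBy.of_deleteEdges {L : Finset (Sym2 V)} {r t : ℕ}
    (hLG : (L : Set (Sym2 V)) ⊆ G.edgeSet)
    (ht : ∀ U, Indep (G.deleteEdges L) U → (L.filter fun e => ∀ v ∈ e, v ∈ U).card ≤ t)
    (h : CutBy (edgeIdeal K (G.deleteEdges L)) r) : CutBy (edgeIdeal K G) (r + t) := by
  obtain ⟨s, hs, hrad⟩ := h
  set g : ℕ → MvPolynomial V K := fun j => ∑ u ∈ L.powersetCard j, ∏ e ∈ u, edgeMonomial K e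
  refine ⟨s ∪ (Icc 1 t).image g, ?_, ?_⟩
  · refine (card_union_le _ _).trans (add_le_add hs (card_image_le.trans (by simp)))
  have hle : edgeIdeal K (G.deleteEdges L) ≤ edgeIdeal K G :=
    edgeIdeal_le_iff.2 fun e he =>
      edgeMonomial_mem (SimpleGraph.edgeSet_mono (G.deleteEdges_le _) he)
  apply le_antisymm
  · rw [Ideal.radical_le_radical_iff, Ideal.span_le]
    intro f hf
    simp only [coe_union, coe_image, Set.mem_union, Set.mem_image] at hf
    rcases hf with hf | ⟨j, hj, rfl⟩
    · have : f ∈ (Ideal.span (s : Set _)).radical := Ideal.le_radical (Ideal.subset_span hf)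
      rw [hrad] at this
      exact Ideal.radical_mono hle this
    · refine Ideal.le_radical (Ideal.sum_mem _ fun u hu => ?_)
      obtain ⟨huL, huc⟩ := mem_powersetCard.1 hu
      have hj1 : 1 ≤ j := (mem_Icc.1 hj).1
      obtain ⟨e, he⟩ := card_pos.1 (by omega : 0 < u.card)
      exact Ideal.mem_of_dvd _ (dvd_prod_of_mem _ he) (edgeMonomial_mem (hLG (huL he)))
  · rw [Ideal.radical_le_radical_iff]
    refine le_radical_of_forall_prime fun P hP hsP => ?_
    have hsub : (Ideal.span (s : Set (MvPolynomial V K))) ≤ P :=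
      (Ideal.span_mono (by simp)).trans hsP
    have hGP : edgeIdeal K (G.deleteEdges L) ≤ P := by
      refine Ideal.le_radical.trans ?_
      rw [← hrad]
      exact hP.radical_le_iff.2 hsub
    have hLP : ∀ e ∈ L, edgeMonomial K e ∈ P := by
      refine mem_of_esymm_mem (P := P) (t := t) L (edgeMonomial K) ?_ fun j hj hjt =>
        hsP (Ideal.subset_span (by
          simp only [coe_union, coe_image, Set.mem_union, Set.mem_image]
          exact Or.inr ⟨j, by simp [hj, hjt], rfl⟩))
      -- The variables outside `P` form an independent set of the smaller graph.
      refine le_trans (card_le_card ?_) (ht (univ.filter fun v => X v ∉ P) ?_)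
      · intro e he
        obtain ⟨heL, heP⟩ := mem_filter.1 he
        exact mem_filter.2 ⟨heL, fun v hv => by simpa using edgeMonomial_notMem heP v hv⟩
      · intro a ha b hb hab
        simp only [mem_filter, mem_univ, true_and] at ha hb
        rcases hP.mem_or_mem (hGP (edgeMonomial_mem (e := s(a, b)) hab)) with h | h
        · exact ha h
        · exact hb h
    refine edgeIdeal_le_iff.2 fun e he => ?_
    by_cases heL : e ∈ L
    · exact hLP e heL
    · exact hGP (edgeMonomial_mem (by simp [he, heL]))

lemma cutBy_of_forall_reducible {p : SimpleGraph V → Prop}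
    (hmono : ∀ G H : SimpleGraph V, H ≤ G → p G → p H)
    (hred : ∀ G : SimpleGraph V, p G → G.edgeSet.Nonempty → Reducible G) (G : SimpleGraph V)
    (hG : p G) : CutBy (edgeIdeal K G) (dom G + ordinaryCount G) := by
  induction hm : G.edgeSet.ncard using Nat.strong_induction_on generalizing G with
  | _ m ih =>
    rcases Set.eq_empty_or_nonempty G.edgeSet with h | h
    · exact (CutBy.of_edgeSet_eq_empty h).mono (Nat.zero_le _)
    obtain ⟨L, t, hL, hLG, ht, hle⟩ := hred G hG h
    refine (CutBy.of_deleteEdges hLG ht (ih _ ?_ _ (hmono _ _ (G.deleteEdges_le _) hG) rfl)).mono hle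
    rw [← hm, SimpleGraph.edgeSet_deleteEdges]
    obtain ⟨e, he⟩ := hL
    exact Set.ncard_lt_ncard ⟨Set.sdiff_subset, fun hsub => (hsub (hLG he)).2 he⟩ (Set.toFinite _)

/-- Minimality of the cover ideal: a smaller prime contains no variable of `B`, yet each vertex
outside `B` has an edge to `B`, so the prime contains its variable. -/
lemma dom_le_bight : (dom G : ℕ∞) ≤ bight (edgeIdeal K G) := by
  obtain ⟨A, hA, hdom⟩ := exists_card_nbrs_eq_dom G
  obtain ⟨B, hAB, hB, hmax⟩ := hA.exists_maximal
  have hmin : coverIdeal K Bᶜ ∈ (edgeIdeal K G).minimalPrimes := by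
    refine ⟨⟨inferInstance, edgeIdeal_le_iff.2 fun e he => ?_⟩, fun q hq hle => ?_⟩
    · induction e with
      | _ x y =>
        by_cases hx : x ∈ B
        · have hy : y ∉ B := fun hy => hB x hx y hy he
          exact Ideal.mul_mem_left _ _ (X_mem_coverIdeal.2 (by simpa using hy))
        · exact Ideal.mul_mem_right _ _ (X_mem_coverIdeal.2 (by simpa using hx))
    · refine coverIdeal_le fun v hv => ?_
      obtain ⟨a, ha, hav⟩ := mem_nbrs.1 (hmax v (by simpa using hv))
      rcases hq.1.mem_or_mem (hq.2 (edgeMonomial_mem (e := s(a, v)) hav)) with h | h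
      · have := X_mem_coverIdeal.1 (hle h)
        simp [ha] at this
      · exact h
  have h1 : (coverIdeal K Bᶜ).height ≤ bight (edgeIdeal K G) :=
    le_iSup₂_of_le (f := fun p (_ : p ∈ (edgeIdeal K G).minimalPrimes) => p.height) _ hmin le_rfl
  refine le_trans ?_ ((card_le_height_coverIdeal Bᶜ).trans h1)
  rw [← hdom]
  refine Nat.cast_le.2 (card_le_card fun v hv => ?_)
  obtain ⟨a, ha, hav⟩ := mem_nbrs.1 hv
  simpa using hB.notMem_of_mem_nbrs (mem_nbrs.2 ⟨a, hAB ha, hav⟩)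

end EdgeIdeal

/-! ### Caps and local exchange arguments -/

section LocalReductions

variable {V : Type*} {G : SimpleGraph V}

/-- An independent set of vertices whose neighbourhoods are cliques. -/
structure IsCapSet (G : SimpleGraph V) (C : Finset V) : Prop where
  indep : Indep G C
  clique : ∀ c ∈ C, ∀ a b, G.Adj c a → G.Adj c b → a ≠ b → G.Adj a b

/-- A vertex that has a neighbour in `C`. -/
def Capped (G : SimpleGraph V) (C : Finset V) (v : V) : Prop :=
  ∃ c ∈ C, G.Adj v c

lemma indep_of_deleteEdges {L : Set (Sym2 V)} {A : Finset V} (hA : Indep (G.deleteEdges L) A)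
    (hL : ∀ a ∈ A, ∀ b ∈ A, s(a, b) ∉ L) : Indep G A :=
  fun a ha b hb hab => hA a ha b hb (by simp [hab, hL a ha b hb])

lemma indep_insert {A : Finset V} {x : V} (hA : Indep G A) (hx : ∀ y ∈ A, ¬ G.Adj x y) :
    Indep G (insert x A) := by
  intro a ha b hb hab
  rcases mem_insert.1 ha with rfl | haA <;> rcases mem_insert.1 hb with rfl | hbA
  · exact G.loopless.irrefl _ hab
  · exact hx b hbA hab
  · exact hx a haA hab.symm
  · exact hA a haA b hbA hab

variable [Fintype V]

lemma nbrs_mono {H : SimpleGraph V} {A B : Finset V} (h : H ≤ G) (hAB : A ⊆ B) :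
    nbrs H A ⊆ nbrs G B := by
  intro v hv
  obtain ⟨a, ha, hav⟩ := mem_nbrs.1 hv
  exact mem_nbrs.2 ⟨a, hAB ha, h hav⟩

/-- Adding caps to an independent set makes it dominate all other capped vertices. -/
lemma IsCapSet.exists_extension {C A : Finset V} (hC : IsCapSet G C) (hA : Indep G A) :
    ∃ B, A ⊆ B ∧ Indep G B ∧ ∀ y, Capped G C y → y ∉ A → y ∈ nbrs G B := by
  have hD : ∀ c ∈ C.filter fun c => ∀ a ∈ A, ¬ G.Adj c a, c ∈ C ∧ ∀ a ∈ A, ¬ G.Adj c a :=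
    fun c hc => mem_filter.1 hc
  refine ⟨A ∪ C.filter fun c => ∀ a ∈ A, ¬ G.Adj c a, subset_union_left, ?_, ?_⟩
  · intro a ha b hb hab
    rcases mem_union.1 ha with haA | haC <;> rcases mem_union.1 hb with hbA | hbC
    · exact hA a haA b hbA hab
    · exact (hD b hbC).2 a haA hab.symm
    · exact (hD a haC).2 b hbA hab
    · exact hC.indep a (hD a haC).1 b (hD b hbC).1 hab
  · rintro y ⟨c, hc, hyc⟩ hyA
    by_cases h : ∀ a ∈ A, ¬ G.Adj c a
    · exact mem_nbrs.2 ⟨c, mem_union_right _ (mem_filter.2 ⟨hc, h⟩), hyc.symm⟩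
    -- This cap is blocked by some `a ∈ A`; as its neighbourhood is a clique, `a` itself dominates
    -- `y`.
    · push Not at h
      obtain ⟨a, ha, hca⟩ := h
      have hay : a ≠ y := fun h => hyA (h ▸ ha)
      exact mem_nbrs.2 ⟨a, mem_union_left _ ha, hC.clique c hc a y hca hyc.symm hay⟩

/-- Deleting the edge `zu` does not increase `dom` if all other neighbours of `z`, except possibly
one, are capped. -/
lemma IsCapSet.dom_deleteEdges_singleton {C : Finset V} (hC : IsCapSet G C) {z u u' : V}
    (h : ∀ y, G.Adj z y → y ≠ u → y ≠ u' → Capped G C y) (hzu : G.Adj z u) (A : Finset V)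
    (hA : Indep (G.deleteEdges {s(z, u)}) A) :
    ∃ B, Indep G B ∧ (nbrs (G.deleteEdges {s(z, u)}) A).card ≤ (nbrs G B).card := by
  -- If both ends are in `A`, drop `z` and add caps: `z` is gained as a neighbour of `u`, and at
  -- most `u'` is lost.
  by_cases hzuA : z ∈ A ∧ u ∈ A
  · obtain ⟨hzA, huA⟩ := hzuA
    have hA0 : Indep G (A.erase z) := by
      refine indep_of_deleteEdges (hA.subset (erase_subset _ _)) fun a ha b hb hab => ?_
      rcases Sym2.eq_iff.1 (Set.mem_singleton_iff.1 hab) with ⟨rfl, rfl⟩ | ⟨rfl, rfl⟩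
      · simp at ha
      · simp at hb
    obtain ⟨B, hAB, hB, hcap⟩ := hC.exists_extension hA0
    refine ⟨B, hB, ?_⟩
    have hz : z ∈ nbrs G B :=
      mem_nbrs.2 ⟨u, hAB (mem_erase.2 ⟨hzu.ne', huA⟩), hzu.symm⟩
    have hsub : nbrs (G.deleteEdges {s(z, u)}) A ⊆ insert u' ((nbrs G B).erase z) := by
      intro y hy
      have hyA := hA.notMem_of_mem_nbrs hy
      have hyz : y ≠ z := fun h => hyA (h ▸ hzA)
      by_cases hyu' : y = u'
      · simp [hyu']
      refine mem_insert_of_mem (mem_erase.2 ⟨hyz, ?_⟩)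
      obtain ⟨a, ha, hay⟩ := mem_nbrs.1 hy
      have hay' := (SimpleGraph.deleteEdges_adj.1 hay)
      by_cases haz : a = z
      · subst haz
        have hyu : y ≠ u := by
          rintro rfl
          exact hay'.2 rfl
        exact hcap y (h y hay'.1 hyu hyu') fun hm => hyA (mem_of_mem_erase hm)
      · exact mem_nbrs.2 ⟨a, hAB (mem_erase.2 ⟨haz, ha⟩), hay'.1⟩
    have h1 := card_le_card hsub
    have h2 := card_insert_le u' ((nbrs G B).erase z)
    have h3 := card_erase_add_one hz
    omega
  · refine ⟨A, ?_, card_le_card (nbrs_mono (G.deleteEdges_le _) subset_rfl)⟩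
    refine indep_of_deleteEdges hA fun a ha b hb hab => hzuA ?_
    rcases Sym2.eq_iff.1 (Set.mem_singleton_iff.1 hab) with ⟨rfl, rfl⟩ | ⟨rfl, rfl⟩
    · exact ⟨ha, hb⟩
    · exact ⟨hb, ha⟩

/-- Exchanging the leaves at `x` for `x` itself. -/
lemma exists_star_exchange {H : SimpleGraph V} (hHG : H ≤ G) {x l : V} {F A : Finset V}
    (hFx : ∀ y ∈ F, G.Adj x y) (hF : ∀ y ∈ F, ∀ w, G.Adj y w → w = x) (hlF : l ∈ F)
    (hl : ¬ H.Adj x l) (hx : ∀ y, G.Adj x y → y ∈ F ∨ y ∉ A) (hA : Indep H A)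
    (hAF : Indep G (A \ F)) :
    ∃ B, Indep G B ∧ (nbrs H A).card + 1 ≤ (nbrs G B).card := by
  refine ⟨insert x (A \ F), indep_insert hAF fun y hy hxy => ?_, ?_⟩
  · obtain ⟨hyA, hyF⟩ := mem_sdiff.1 hy
    rcases hx y hxy with h | h
    · exact hyF h
    · exact h hyA
  have hsub : nbrs H A \ insert x F ∪ F ⊆ nbrs G (insert x (A \ F)) := by
    intro y hy
    rcases mem_union.1 hy with hy | hy
    · obtain ⟨hyN, hyF⟩ := mem_sdiff.1 hy
      obtain ⟨a, ha, hay⟩ := mem_nbrs.1 hyN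
      refine mem_nbrs.2 ⟨a, mem_insert_of_mem (mem_sdiff.2 ⟨ha, fun haF => hyF ?_⟩), hHG hay⟩
      rw [hF a haF y (hHG hay)]
      exact mem_insert_self _ _
    · exact mem_nbrs.2 ⟨x, mem_insert_self _ _, hFx y hy⟩
  have h1 := card_le_card hsub
  have hdisj : Disjoint (nbrs H A \ insert x F) F :=
    disjoint_left.2 fun y hy hyF => (mem_sdiff.1 hy).2 (mem_insert_of_mem hyF)
  rw [card_union_of_disjoint hdisj] at h1
  have h2 := card_sdiff_add_card_inter (nbrs H A) (insert x F)
  suffices (nbrs H A ∩ insert x F).card + 1 ≤ F.card by omega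
  -- If `A` dominates `x`, it dominates no vertex of `F`, while `F` contains `l` and a second
  -- vertex, one dominating `x`. Otherwise `l` is the vertex of `F` that was missing.
  by_cases hxN : x ∈ nbrs H A
  · have hxA := hA.notMem_of_mem_nbrs hxN
    obtain ⟨a, ha, hax⟩ := mem_nbrs.1 hxN
    have haF : a ∈ F := (hx a (hHG hax).symm).resolve_right (not_not.2 ha)
    have hal : a ≠ l := by
      rintro rfl
      exact hl hax.symm
    have h3 : (nbrs H A ∩ insert x F) ⊆ {x} := by
      intro y hy
      obtain ⟨hyN, hyF⟩ := mem_inter.1 hy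
      rcases mem_insert.1 hyF with rfl | hyF
      · simp
      · obtain ⟨b, hb, hby⟩ := mem_nbrs.1 hyN
        exact (hxA (hF y hyF b (hHG hby).symm ▸ hb)).elim
    have h4 : ({a, l} : Finset V) ⊆ F := by
      intro y hy
      rcases mem_insert.1 hy with rfl | hy
      · exact haF
      · rw [mem_singleton.1 hy]; exact hlF
    have h5 := card_le_card h3
    have h6 := card_le_card h4
    rw [card_pair hal] at h6
    rw [card_singleton] at h5
    omega
  · have h3 : (nbrs H A ∩ insert x F) ⊆ F.erase l := by
      intro y hy
      obtain ⟨hyN, hyF⟩ := mem_inter.1 hy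
      rcases mem_insert.1 hyF with rfl | hyF
      · exact (hxN hyN).elim
      · refine mem_erase.2 ⟨?_, hyF⟩
        rintro rfl
        obtain ⟨b, hb, hby⟩ := mem_nbrs.1 hyN
        obtain rfl := hF y hyF b (hHG hby).symm
        exact hl hby
    have h4 := card_le_card h3
    have h5 := card_erase_add_one hlF
    omega

/-- A component that is a star can be reduced. -/
lemma reducible_of_star {x l : V} (hl : G.Adj x l)
    (hleaf : ∀ y, G.Adj x y → ∀ w, G.Adj y w → w = x) : Reducible G := by
  refine reducible_of_dom (L := {s(x, l)}) (t := 1) (singleton_nonempty _) (by simpa using hl)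
    (fun U _ => (card_filter_le _ _).trans (by simp)) fun A hA => ?_
  refine exists_star_exchange (G.deleteEdges_le _) (x := x) (l := l)
    (F := univ.filter fun y => G.Adj x y) (by simp) (by simpa using hleaf) (by simpa using hl)
    (by simp) (fun y hy => Or.inl (by simpa using hy)) hA ?_
  refine indep_of_deleteEdges (hA.subset sdiff_subset) fun a ha b hb hab => ?_
  simp only [coe_singleton, Set.mem_singleton_iff] at hab
  simp only [mem_sdiff, mem_filter, mem_univ, true_and] at ha hb
  rcases Sym2.eq_iff.1 hab with ⟨rfl, rfl⟩ | ⟨rfl, rfl⟩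
  · exact hb.2 hl
  · exact ha.2 hl

/-- A star attached to a vertex `z` can be reduced if the other neighbours of `z`, except possibly
one, are capped. -/
lemma IsCapSet.reducible_of_pendant_star {C : Finset V} (hC : IsCapSet G C) {x l z : V}
    {Y : Finset V} (hl : G.Adj x l) (hlz : l ≠ z) (hxz : G.Adj x z)
    (hleaf : ∀ y, G.Adj x y → y ≠ z → ∀ w, G.Adj y w → w = x)
    (hY : Y.card ≤ 1) (hYz : ∀ u ∈ Y, G.Adj z u) (hxY : x ∉ Y)
    (hz : ∀ y, G.Adj z y → y ≠ x → y ∉ Y → Capped G C y) : Reducible G := by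
  set L : Finset (Sym2 V) := {s(x, l)} ∪ Y.image fun u => s(z, u) with hLdef
  have hmem : ∀ e : Sym2 V, e ∈ (L : Set (Sym2 V)) ↔ e = s(x, l) ∨ ∃ u ∈ Y, s(z, u) = e := by
    intro e
    simp [hLdef]
  have hxzL : s(x, z) ∉ (L : Set (Sym2 V)) := by
    rw [hmem]
    rintro (h | ⟨u, hu, h⟩)
    · rcases Sym2.eq_iff.1 h with ⟨-, h⟩ | ⟨h, -⟩
      · exact hlz h.symm
      · exact hl.ne h
    · rcases Sym2.eq_iff.1 h with ⟨h, -⟩ | ⟨-, h⟩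
      · exact hxz.ne h.symm
      · exact hxY (h ▸ hu)
  have hxzH : (G.deleteEdges (L : Set (Sym2 V))).Adj x z :=
    SimpleGraph.deleteEdges_adj.2 ⟨hxz, hxzL⟩
  set F : Finset V := univ.filter fun y => G.Adj x y ∧ y ≠ z with hFdef
  have hmemF : ∀ y, y ∈ F ↔ G.Adj x y ∧ y ≠ z := by simp [hFdef]
  refine reducible_of_dom (L := L) (t := 1) ⟨s(x, l), by simp [hLdef]⟩ ?_ ?_ ?_
  · intro e he
    rcases (hmem e).1 he with rfl | ⟨u, hu, rfl⟩
    · exact hl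
    · exact hYz u hu
  · intro U hU
    have : Nonempty V := ⟨x⟩
    rcases Finset.card_le_one_iff_subset_singleton.1 hY with ⟨u, hu⟩
    refine le_trans (card_le_card (filter_subset_filter _ ?_)) (card_filter_pair_le hU
      (e := s(x, l)) (f := s(z, u)) (Sym2.mem_mk_left _ _) (Sym2.mem_mk_left _ _) hxzH)
    intro e he
    rcases (hmem e).1 he with rfl | ⟨u', hu', rfl⟩
    · simp
    · simp [mem_singleton.1 (hu hu')]
  intro A hA
  -- If `z ∈ A`, exchange `z` and the leaves for `x` and add caps: `l` and `z` are gained, at most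
  -- `x` is lost. The edge to `Y` was deleted because a vertex of `Y` need not be capped. If `z ∉
  -- A`, the star exchange applies.
  by_cases hzA : z ∈ A
  · have hxA : x ∉ A := fun hxA => hA x hxA z hzA hxzH
    have hA0 : Indep G (insert x (A.erase z \ F)) := by
      refine indep_insert (indep_of_deleteEdges
        (hA.subset (sdiff_subset.trans (erase_subset _ _))) fun a ha b hb hab => ?_) ?_
      · simp only [mem_sdiff, mem_erase] at ha hb
        rcases (hmem _).1 hab with h | ⟨u, hu, h⟩
        · rcases Sym2.eq_iff.1 h with ⟨rfl, -⟩ | ⟨-, rfl⟩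
          · exact hxA ha.1.2
          · exact hxA hb.1.2
        · rcases Sym2.eq_iff.1 h with ⟨h, -⟩ | ⟨h, -⟩
          · exact ha.1.1 h.symm
          · exact hb.1.1 h.symm
      · intro y hy hxy
        simp only [mem_sdiff, mem_erase, hmemF] at hy
        exact hy.2 ⟨hxy, hy.1.1⟩
    obtain ⟨B, hAB, hB, hcap⟩ := hC.exists_extension hA0
    refine ⟨B, hB, ?_⟩
    have hxB : x ∈ B := hAB (mem_insert_self _ _)
    have hsub : (nbrs (G.deleteEdges L) A).erase x ∪ {l, z} ⊆ nbrs G B := by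
      intro y hy
      rcases mem_union.1 hy with hy | hy
      · obtain ⟨hyx, hyN⟩ := mem_erase.1 hy
        have hyA := hA.notMem_of_mem_nbrs hyN
        obtain ⟨a, ha, hay⟩ := mem_nbrs.1 hyN
        obtain ⟨hayG, hayL⟩ := SimpleGraph.deleteEdges_adj.1 hay
        by_cases haz : a = z
        · subst haz
          refine hcap y (hz y hayG hyx fun hyY => hayL ((hmem _).2 (Or.inr ⟨y, hyY, rfl⟩))) ?_
          simp [hyx, hyA]
        · by_cases haF : a ∈ F
          · exact (hyx (hleaf a ((hmemF a).1 haF).1 haz y hayG)).elim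
          · exact mem_nbrs.2 ⟨a, hAB (mem_insert_of_mem
              (mem_sdiff.2 ⟨mem_erase.2 ⟨haz, ha⟩, haF⟩)), hayG⟩
      · rcases mem_insert.1 hy with rfl | hy
        · exact mem_nbrs.2 ⟨x, hxB, hl⟩
        · rw [mem_singleton.1 hy]
          exact mem_nbrs.2 ⟨x, hxB, hxz⟩
    have hlN : l ∉ nbrs (G.deleteEdges L) A := by
      intro h
      obtain ⟨a, ha, hal⟩ := mem_nbrs.1 h
      exact hxA (hleaf l hl hlz a (G.deleteEdges_le _ hal).symm ▸ ha)
    have hzN : z ∉ nbrs (G.deleteEdges L) A := fun h => hA.notMem_of_mem_nbrs h hzA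
    have hdisj : Disjoint ((nbrs (G.deleteEdges L) A).erase x) {l, z} := by
      rw [disjoint_left]
      intro y hy hy'
      rcases mem_insert.1 hy' with rfl | hy'
      · exact hlN (mem_of_mem_erase hy)
      · rw [mem_singleton.1 hy'] at hy
        exact hzN (mem_of_mem_erase hy)
    have h1 := card_le_card hsub
    rw [card_union_of_disjoint hdisj, card_pair hlz] at h1
    have h2 := pred_card_le_card_erase (s := nbrs (G.deleteEdges L) A) (a := x)
    omega
  · refine exists_star_exchange (G.deleteEdges_le _) (x := x) (l := l) (F := F)
      (fun y hy => ((hmemF y).1 hy).1)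
      (fun y hy => hleaf y ((hmemF y).1 hy).1 ((hmemF y).1 hy).2) ((hmemF l).2 ⟨hl, hlz⟩) ?_ ?_ hA ?_
    · intro h
      exact (SimpleGraph.deleteEdges_adj.1 h).2 ((hmem _).2 (Or.inl rfl))
    · intro y hy
      by_cases hyz : y = z
      · exact Or.inr (hyz ▸ hzA)
      · exact Or.inl ((hmemF y).2 ⟨hy, hyz⟩)
    · refine indep_of_deleteEdges (hA.subset sdiff_subset) fun a ha b hb hab => ?_
      simp only [mem_sdiff, hmemF] at ha hb
      rcases (hmem _).1 hab with h | ⟨u, hu, h⟩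
      · rcases Sym2.eq_iff.1 h with ⟨rfl, rfl⟩ | ⟨rfl, rfl⟩
        · exact hb.2 ⟨hl, hlz⟩
        · exact ha.2 ⟨hl, hlz⟩
      · rcases Sym2.eq_iff.1 h with ⟨rfl, -⟩ | ⟨rfl, -⟩
        · exact hzA ha.1
        · exact hzA hb.1

/-- Two adjacent vertices, each with a cap, the first one having no further neighbours. -/
lemma reducible_of_adjacent_caps {v v' c c' : V} (hvv' : G.Adj v v') (hvc : G.Adj v c)
    (hv : ∀ y, G.Adj v y → y = v' ∨ y = c) (hc : ∀ y, G.Adj c y → y = v ∨ y = v')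
    (hvc' : G.Adj v' c') (hc' : ∀ y, G.Adj c' y → y ≠ v' → G.Adj v' y)
    (hne : c' ≠ v) (hne' : c ≠ v') : Reducible G := by
  set L : Finset (Sym2 V) := {s(v, c), s(v', c')} with hLdef
  have hmem : ∀ e : Sym2 V, e ∈ (L : Set (Sym2 V)) ↔ e = s(v, c) ∨ e = s(v', c') := by
    intro e
    simp [hLdef]
  have hlink : (G.deleteEdges (L : Set (Sym2 V))).Adj v v' := by
    refine SimpleGraph.deleteEdges_adj.2 ⟨hvv', fun h => ?_⟩
    rcases (hmem _).1 h with h | h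
    · rcases Sym2.eq_iff.1 h with ⟨-, h⟩ | ⟨h, -⟩
      · exact hne' h.symm
      · exact hvc.ne h
    · rcases Sym2.eq_iff.1 h with ⟨h, -⟩ | ⟨h, -⟩
      · exact hvv'.ne h
      · exact hne h.symm
  have hHG := G.deleteEdges_le (L : Set (Sym2 V))
  refine reducible_of_dom (L := L) (t := 1) (by simp [hLdef]) ?_
    (fun U hU => card_filter_pair_le hU (Sym2.mem_mk_left _ _) (Sym2.mem_mk_left _ _) hlink) ?_
  · intro e he
    rcases (hmem e).1 he with rfl | rfl
    · exact hvc
    · exact hvc'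
  intro A hA
  have hsucc : ∀ {B : Finset V} {w : V}, w ∉ nbrs (G.deleteEdges L) A → w ∈ nbrs G B →
      nbrs (G.deleteEdges L) A ⊆ nbrs G B →
      (nbrs (G.deleteEdges L) A).card + 1 ≤ (nbrs G B).card := by
    intro B w hw hwB hsub
    exact card_lt_card ((ssubset_iff_of_subset hsub).2 ⟨w, hwB, hw⟩)
  -- No neighbour is lost in any case. The gain is `c'` if `v' ∈ A`, `c` if `v ∈ A`, and `v`, after
  -- adding `c`, if neither is.
  by_cases hv'A : v' ∈ A
  · have hvA : v ∉ A := fun h => hA v h v' hv'A hlink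
    refine ⟨A \ {c, c'}, ?_, hsucc (w := c') ?_ ?_ ?_⟩
    · refine indep_of_deleteEdges (hA.subset sdiff_subset) fun a ha b hb hab => ?_
      simp only [mem_sdiff, mem_insert, mem_singleton, not_or] at ha hb
      rcases (hmem _).1 hab with h | h
      · rcases Sym2.eq_iff.1 h with ⟨-, rfl⟩ | ⟨rfl, -⟩
        · exact hb.2.1 rfl
        · exact ha.2.1 rfl
      · rcases Sym2.eq_iff.1 h with ⟨-, rfl⟩ | ⟨rfl, -⟩
        · exact hb.2.2 rfl
        · exact ha.2.2 rfl
    · intro h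
      obtain ⟨a, ha, hac⟩ := mem_nbrs.1 h
      obtain ⟨hac, hacL⟩ := SimpleGraph.deleteEdges_adj.1 hac
      by_cases hav : a = v'
      · subst hav
        exact hacL ((hmem _).2 (Or.inr rfl))
      · have h1 := hc' a hac.symm hav
        refine hA a ha v' hv'A (SimpleGraph.deleteEdges_adj.2 ⟨h1.symm, fun h => ?_⟩)
        rcases (hmem _).1 h with h | h
        · rcases Sym2.eq_iff.1 h with ⟨h, -⟩ | ⟨-, h⟩
          · exact hvA (h ▸ ha)
          · exact hvv'.ne h.symm
        · rcases Sym2.eq_iff.1 h with ⟨h, -⟩ | ⟨h, -⟩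
          · exact hav h
          · exact hac.ne h
    · exact mem_nbrs.2 ⟨v', by simp [hv'A, hne'.symm, hvc'.ne], hvc'⟩
    · intro y hy
      have hyA := hA.notMem_of_mem_nbrs hy
      obtain ⟨a, ha, hay⟩ := mem_nbrs.1 hy
      have hyv' : y ≠ v' := fun h => hyA (h ▸ hv'A)
      have hv'B : v' ∈ A \ {c, c'} := by simp [hv'A, hne'.symm, hvc'.ne]
      by_cases hac' : a = c'
      · subst hac'
        exact mem_nbrs.2 ⟨v', hv'B, hc' y (hHG hay) hyv'⟩
      by_cases hac : a = c
      · subst hac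
        rcases hc y (hHG hay) with rfl | rfl
        · exact mem_nbrs.2 ⟨v', hv'B, hvv'.symm⟩
        · exact (hyv' rfl).elim
      exact mem_nbrs.2 ⟨a, by simp [ha, hac, hac'], hHG hay⟩
  by_cases hvA : v ∈ A
  · refine ⟨A \ {c}, ?_, hsucc (w := c) ?_ ?_ ?_⟩
    · refine indep_of_deleteEdges (hA.subset sdiff_subset) fun a ha b hb hab => ?_
      simp only [mem_sdiff, mem_singleton] at ha hb
      rcases (hmem _).1 hab with h | h
      · rcases Sym2.eq_iff.1 h with ⟨-, rfl⟩ | ⟨rfl, -⟩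
        · exact hb.2 rfl
        · exact ha.2 rfl
      · rcases Sym2.eq_iff.1 h with ⟨rfl, -⟩ | ⟨-, rfl⟩
        · exact hv'A ha.1
        · exact hv'A hb.1
    · intro h
      obtain ⟨a, ha, hac⟩ := mem_nbrs.1 h
      obtain ⟨hac, hacL⟩ := SimpleGraph.deleteEdges_adj.1 hac
      rcases hc a hac.symm with rfl | rfl
      · exact hacL ((hmem _).2 (Or.inl rfl))
      · exact hv'A ha
    · exact mem_nbrs.2 ⟨v, by simp [hvA, hvc.ne], hvc⟩
    · intro y hy
      have hyA := hA.notMem_of_mem_nbrs hy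
      obtain ⟨a, ha, hay⟩ := mem_nbrs.1 hy
      by_cases hac : a = c
      · subst hac
        rcases hc y (hHG hay) with rfl | rfl
        · exact (hyA hvA).elim
        · exact mem_nbrs.2 ⟨v, by simp [hvA, hvc.ne], hvv'⟩
      · exact mem_nbrs.2 ⟨a, by simp [ha, hac], hHG hay⟩
  · refine ⟨insert c A, ?_, hsucc (w := v) ?_ ?_ (nbrs_mono hHG (subset_insert _ _))⟩
    · refine indep_insert (indep_of_deleteEdges hA fun a ha b hb hab => ?_) fun y hy hcy => ?_
      · rcases (hmem _).1 hab with h | h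
        · rcases Sym2.eq_iff.1 h with ⟨rfl, -⟩ | ⟨-, rfl⟩
          · exact hvA ha
          · exact hvA hb
        · rcases Sym2.eq_iff.1 h with ⟨rfl, -⟩ | ⟨-, rfl⟩
          · exact hv'A ha
          · exact hv'A hb
      · rcases hc y hcy with rfl | rfl
        · exact hvA hy
        · exact hv'A hy
    · intro h
      obtain ⟨a, ha, hav⟩ := mem_nbrs.1 h
      obtain ⟨hav, havL⟩ := SimpleGraph.deleteEdges_adj.1 hav
      rcases hv a hav.symm with rfl | rfl
      · exact hv'A ha
      · exact havL ((hmem _).2 (Or.inl Sym2.eq_swap))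
    · exact mem_nbrs.2 ⟨c, mem_insert_self _ _, hvc.symm⟩

end LocalReductions

/-! ### Clusters: reductions where no vertex is bare -/

section Clusters

variable {V : Type*} {G : SimpleGraph V}

/-- A set `W` of capped vertices and caps that is joined to its complement by at most one edge, the
end of which in `W` is `x`. -/
structure IsCluster (G : SimpleGraph V) (C W : Finset V) (x : V) : Prop where
  mem : x ∈ W
  notMem : x ∉ C
  edge : ∀ v ∈ W, ∀ y ∉ W, G.Adj v y → v = x ∧ y ∉ C
  unique : ∀ y ∉ W, ∀ y' ∉ W, G.Adj x y → G.Adj x y' → y = y'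
  capped : ∀ v ∈ W, v ∉ C → Capped G C v

/-- The caps at a vertex. -/
noncomputable def caps (G : SimpleGraph V) (C : Finset V) (v : V) : Finset V :=
  C.filter fun c => G.Adj v c

lemma mem_caps {C : Finset V} {v c : V} : c ∈ caps G C v ↔ c ∈ C ∧ G.Adj v c := by simp [caps]

variable {C W : Finset V} {x : V}

lemma IsCluster.caps_subset (hW : IsCluster G C W x) {v : V} (hv : v ∈ W) : caps G C v ⊆ W := by
  intro c hc
  obtain ⟨hcC, hvc⟩ := mem_caps.1 hc
  by_contra hcW
  exact (hW.edge v hv c hcW hvc).2 hcC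

lemma IsCluster.one_le_card_caps (hW : IsCluster G C W x) {v : V} (hv : v ∈ W \ C) :
    1 ≤ (caps G C v).card := by
  obtain ⟨c, hc, hvc⟩ := hW.capped v (mem_sdiff.1 hv).1 (mem_sdiff.1 hv).2
  exact card_pos.2 ⟨c, mem_caps.2 ⟨hc, hvc⟩⟩

lemma IsCapSet.disjoint_caps (hC : IsCapSet G C) {S : Finset V} (hS : Indep G S) :
    (S : Set V).PairwiseDisjoint (caps G C) := by
  intro a ha b hb hab
  refine disjoint_left.2 fun c hca hcb => hS a ha b hb ?_
  obtain ⟨hc, hac⟩ := mem_caps.1 hca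
  exact hC.clique c hc a b hac.symm (mem_caps.1 hcb).2.symm hab

variable [Fintype V]

/-- An independent set of core vertices of a cluster, filled up with caps. -/
lemma IsCluster.exists_fill (hC : IsCapSet G C) (hW : IsCluster G C W x) {S : Finset V}
    (hSW : S ⊆ W \ C) (hS : Indep G S) :
    ∃ D ⊆ W, S ⊆ D ∧ D ⊆ S ∪ C ∧ Indep G D ∧
      (W \ C).card + ∑ v ∈ S, ((caps G C v).card - 1) ≤ (nbrs G D ∩ W).card := by
  -- Add all caps in `W` not adjacent to `S`. Every vertex of `W \ C` outside `S` is then dominated,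
  -- and so are the caps at `S`, which are disjoint for different vertices of `S`.
  set F := (C ∩ W).filter fun c => ∀ s ∈ S, ¬ G.Adj c s with hFdef
  have hF : ∀ c, c ∈ F ↔ (c ∈ C ∧ c ∈ W) ∧ ∀ s ∈ S, ¬ G.Adj c s := by simp [hFdef]
  refine ⟨S ∪ F, ?_, subset_union_left, ?_, ?_, ?_⟩
  · refine union_subset (hSW.trans sdiff_subset) fun c hc => ((hF c).1 hc).1.2
  · exact union_subset_union subset_rfl fun c hc => ((hF c).1 hc).1.1
  · intro a ha b hb hab
    rcases mem_union.1 ha with ha | ha <;> rcases mem_union.1 hb with hb | hb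
    · exact hS a ha b hb hab
    · exact ((hF b).1 hb).2 a ha hab.symm
    · exact ((hF a).1 ha).2 b hb hab
    · exact hC.indep a ((hF a).1 ha).1.1 b ((hF b).1 hb).1.1 hab
  have hsub : (W \ C) \ S ∪ S.biUnion (caps G C) ⊆ nbrs G (S ∪ F) ∩ W := by
    intro y hy
    rcases mem_union.1 hy with hy | hy
    · obtain ⟨hyW, hyS⟩ := mem_sdiff.1 hy
      obtain ⟨hyW, hyC⟩ := mem_sdiff.1 hyW
      refine mem_inter.2 ⟨?_, hyW⟩
      obtain ⟨c, hc, hyc⟩ := hW.capped y hyW hyC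
      by_cases h : ∀ s ∈ S, ¬ G.Adj c s
      · exact mem_nbrs.2 ⟨c, mem_union_right _
          ((hF c).2 ⟨⟨hc, hW.caps_subset hyW (mem_caps.2 ⟨hc, hyc⟩)⟩, h⟩), hyc.symm⟩
      · push Not at h
        obtain ⟨s, hs, hcs⟩ := h
        exact mem_nbrs.2 ⟨s, mem_union_left _ hs, hC.clique c hc s y hcs hyc.symm
          fun h => hyS (h ▸ hs)⟩
    · obtain ⟨s, hs, hys⟩ := mem_biUnion.1 hy
      exact mem_inter.2 ⟨mem_nbrs.2 ⟨s, mem_union_left _ hs, (mem_caps.1 hys).2⟩,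
        hW.caps_subset (mem_sdiff.1 (hSW hs)).1 hys⟩
  have hdisj : Disjoint ((W \ C) \ S) (S.biUnion (caps G C)) := by
    refine disjoint_left.2 fun y hy hy' => ?_
    obtain ⟨s, hs, hys⟩ := mem_biUnion.1 hy'
    exact (mem_sdiff.1 (mem_sdiff.1 hy).1).2 (mem_caps.1 hys).1
  have h1 := card_le_card hsub
  rw [card_union_of_disjoint hdisj, card_biUnion (hC.disjoint_caps hS)] at h1
  have h2 := card_sdiff_add_card_eq_card hSW
  have h3 : ∑ v ∈ S, (caps G C v).card = ∑ v ∈ S, ((caps G C v).card - 1) + S.card := by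
    rw [card_eq_sum_ones, ← sum_add_distrib]
    exact sum_congr rfl fun v hv => (Nat.sub_add_cancel (hW.one_le_card_caps (hSW hv))).symm
  omega

/-- The part of the neighbourhood of an independent set in a cluster all of whose vertices
except `x` have one cap. -/
lemma card_nbrs_inter_le {H : SimpleGraph V} (hC : Indep H C)
    (hedge : ∀ v ∈ W, ∀ y ∉ W, H.Adj v y → v ∉ C) {m : V → ℕ}
    (hcaps : ∀ v ∈ W \ C, (caps H C v).card ≤ 1 + m v) {A : Finset V} (hA : Indep H A) :
    (nbrs H A ∩ W).card ≤ (W \ C).card + ∑ v ∈ A ∩ (W \ C), m v := by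
  -- Each vertex of `A` in `W \ C` is itself not a neighbour, which makes up for one of its caps.
  have hsub : nbrs H A ∩ W ⊆
      (W \ C) \ (A ∩ (W \ C)) ∪ (A ∩ (W \ C)).biUnion (caps H C) := by
    intro y hy
    obtain ⟨hyN, hyW⟩ := mem_inter.1 hy
    have hyA := hA.notMem_of_mem_nbrs hyN
    obtain ⟨a, ha, hay⟩ := mem_nbrs.1 hyN
    by_cases hyC : y ∈ C
    · refine mem_union_right _ (mem_biUnion.2 ⟨a, ?_, mem_caps.2 ⟨hyC, hay⟩⟩)
      refine mem_inter.2 ⟨ha, mem_sdiff.2 ⟨?_, fun haC => hC a haC y hyC hay⟩⟩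
      by_contra haW
      exact hedge y hyW a haW hay.symm hyC
    · exact mem_union_left _ (by simp [hyW, hyC, hyA])
  have h1 := (card_le_card hsub).trans (card_union_le _ _)
  have h2 := card_sdiff_add_card_eq_card (s := A ∩ (W \ C)) (t := W \ C) inter_subset_right
  have h3 : ((A ∩ (W \ C)).biUnion (caps H C)).card ≤
      (A ∩ (W \ C)).card + ∑ v ∈ A ∩ (W \ C), m v := by
    refine card_biUnion_le.trans ?_
    rw [card_eq_sum_ones, ← sum_add_distrib]
    exact sum_le_sum fun v hv => hcaps v (mem_inter.1 hv).2
  omega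

/-- A cluster in which a vertex other than `x` has several caps can be reduced. -/
lemma IsCluster.reducible_of_excess (hC : IsCapSet G C) (hW : IsCluster G C W x) {v₀ : V}
    (hv₀ : v₀ ∈ W \ C) (hv₀x : v₀ ≠ x) (hcard : 2 ≤ (caps G C v₀).card) : Reducible G := by
  set wt : Finset V → ℕ := fun S => ∑ v ∈ S, ((caps G C v).card - 1) with hwt
  have hxΩ : x ∈ W \ C := mem_sdiff.2 ⟨hW.mem, hW.notMem⟩
  obtain ⟨S₀, hS₀, hmax₀⟩ := exists_max_image
    (univ.filter fun S : Finset V => S ⊆ W \ C ∧ Indep G S ∧ x ∉ S) wt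
    ⟨∅, by simp [indep_empty]⟩
  obtain ⟨S₁, hS₁, hmax₁⟩ := exists_max_image
    (univ.filter fun S : Finset V => S ⊆ W \ C ∧ Indep G S ∧ x ∈ S) wt
    ⟨{x}, mem_filter.2 ⟨mem_univ _, by simpa using hxΩ, by simp [Indep], by simp⟩⟩
  simp only [mem_filter, mem_univ, true_and] at hS₀ hmax₀ hS₁ hmax₁
  -- All caps but one are cut off at each vertex, except that `x` keeps `d` more; so an independent
  -- set contains at most `wt S₀` of these deleted edges. If `wt S₁ < wt S₀`, then `d = 0` by
  -- truncation, and sets through `x` have room for one more deleted edge, the one leaving `W`.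
  set d := wt S₁ - wt S₀ with hd
  have hdx : d ≤ (caps G C x).card - 1 := by
    have h1 := hmax₀ (S₁.erase x) ⟨(erase_subset _ _).trans hS₁.1,
      hS₁.2.1.subset (erase_subset _ _), by simp⟩
    have h2 : wt S₁ = ((caps G C x).card - 1) + wt (S₁.erase x) :=
      (add_sum_erase _ _ hS₁.2.2).symm
    omega
  set m : V → ℕ := fun v => if v = x then d else 0 with hm
  have hR : ∀ v, ∃ R ⊆ caps G C v, R.card = (caps G C v).card - 1 - m v := fun v =>
    exists_subset_card_eq (by omega)
  choose R hRsub hRcard using hR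
  have hmle : ∀ v, m v ≤ (caps G C v).card - 1 := by
    intro v
    by_cases hv : v = x
    · simpa [hm, hv] using hdx
    · simp [hm, hv]
  set LR : Finset (Sym2 V) := (W \ C).biUnion fun v => (R v).image fun c => s(v, c) with hLR
  set O : Finset V := univ.filter fun y => (y ∉ W ∧ G.Adj x y) ∧ wt S₁ < wt S₀ with hO
  set L : Finset (Sym2 V) := LR ∪ O.image fun y => s(x, y) with hL
  have hmemLR : ∀ e, e ∈ LR ↔ ∃ v ∈ W \ C, ∃ c ∈ R v, s(v, c) = e := by
    intro e; simp only [hLR, mem_biUnion, mem_image]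
  have hmemO : ∀ y, y ∈ O ↔ (y ∉ W ∧ G.Adj x y) ∧ wt S₁ < wt S₀ := by
    intro y; simp only [hO, mem_filter, mem_univ, true_and]
  have hmemL : ∀ e : Sym2 V, e ∈ (L : Set (Sym2 V)) ↔
      (∃ v ∈ W \ C, ∃ c ∈ R v, s(v, c) = e) ∨ ∃ y ∈ O, s(x, y) = e := by
    intro e
    rw [mem_coe, hL, mem_union, hmemLR, mem_image]
  have hcore : ∀ a ∈ W \ C, ∀ b ∈ W \ C, s(a, b) ∉ (L : Set (Sym2 V)) := by
    intro a ha b hb hab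
    rcases (hmemL _).1 hab with ⟨v, -, c, hc, h⟩ | ⟨y, hy, h⟩
    · have hcC := (mem_caps.1 (hRsub v hc)).1
      rcases Sym2.eq_iff.1 h with ⟨-, rfl⟩ | ⟨-, rfl⟩
      · exact (mem_sdiff.1 hb).2 hcC
      · exact (mem_sdiff.1 ha).2 hcC
    · have hyW := ((hmemO y).1 hy).1.1
      rcases Sym2.eq_iff.1 h with ⟨-, rfl⟩ | ⟨-, rfl⟩
      · exact hyW (mem_sdiff.1 hb).1
      · exact hyW (mem_sdiff.1 ha).1
  have hout : ∀ y ∉ W, s(x, y) ∈ (L : Set (Sym2 V)) → wt S₁ < wt S₀ := by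
    intro y hy h
    rcases (hmemL _).1 h with ⟨v, hv, c, hc, h⟩ | ⟨y', hy', -⟩
    · have hcC := (mem_caps.1 (hRsub v hc)).1
      rcases Sym2.eq_iff.1 h with ⟨rfl, rfl⟩ | ⟨rfl, -⟩
      · exact (hy (hW.caps_subset hW.mem (hRsub _ hc))).elim
      · exact (hy (mem_sdiff.1 hv).1).elim
    · exact ((hmemO y').1 hy').2
  have hRwt : ∀ S ⊆ W \ C, Indep G S → ∑ v ∈ S, (R v).card ≤ wt S₀ ∧
      (x ∈ S → ∑ v ∈ S, (R v).card ≤ wt S₁) := by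
    intro S hSW hS
    have h1 : ∑ v ∈ S, (R v).card + ∑ v ∈ S, m v = wt S := by
      rw [← sum_add_distrib]
      refine sum_congr rfl fun v _ => ?_
      rw [hRcard]
      exact Nat.sub_add_cancel (hmle v)
    by_cases hxS : x ∈ S
    · have h2 := hmax₁ S ⟨hSW, hS, hxS⟩
      have h3 : ∑ v ∈ S, m v = d := by simp [hm, hxS]
      exact ⟨by omega, fun _ => by omega⟩
    · have h2 := hmax₀ S ⟨hSW, hS, hxS⟩
      exact ⟨by omega, fun h => (hxS h).elim⟩
  have hHG := G.deleteEdges_le (L : Set (Sym2 V))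
  refine reducible_of_dom (L := L) (t := wt S₀) ?_ ?_ ?_ ?_
  · obtain ⟨c, hc⟩ : (R v₀).Nonempty := by
      rw [← card_pos, hRcard]
      simp only [hm, hv₀x, if_false]
      omega
    exact ⟨s(v₀, c), (hmemL _).2 (Or.inl ⟨v₀, hv₀, c, hc, rfl⟩)⟩
  · intro e he
    rcases (hmemL e).1 he with ⟨v, -, c, hc, rfl⟩ | ⟨y, hy, rfl⟩
    · exact (mem_caps.1 (hRsub v hc)).2
    · exact ((hmemO y).1 hy).1.2
  · intro U hU
    have hSG : Indep G (U ∩ (W \ C)) :=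
      indep_of_deleteEdges (hU.subset inter_subset_left) fun a ha b hb =>
        hcore a (mem_inter.1 ha).2 b (mem_inter.1 hb).2
    obtain ⟨h0, h1⟩ := hRwt _ inter_subset_right hSG
    have hLRcard : (LR.filter fun e => ∀ v ∈ e, v ∈ U).card ≤
        ∑ v ∈ U ∩ (W \ C), (R v).card := by
      refine le_trans (card_le_card (t := (U ∩ (W \ C)).biUnion fun v =>
        (R v).image fun c => s(v, c)) ?_) (card_biUnion_le.trans
        (sum_le_sum fun v _ => card_image_le))
      intro e he
      obtain ⟨he, heU⟩ := mem_filter.1 he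
      obtain ⟨v, hv, c, hc, rfl⟩ := (hmemLR e).1 he
      exact mem_biUnion.2 ⟨v, mem_inter.2 ⟨heU v (Sym2.mem_mk_left _ _), hv⟩,
        mem_image.2 ⟨c, hc, rfl⟩⟩
    rw [hL, filter_union]
    refine (card_union_le _ _).trans ?_
    by_cases hO' : ((O.image fun y => s(x, y)).filter fun e => ∀ v ∈ e, v ∈ U).Nonempty
    · obtain ⟨e, he⟩ := hO'
      obtain ⟨he, heU⟩ := mem_filter.1 he
      obtain ⟨y, hy, rfl⟩ := mem_image.1 he
      have hlt := ((hmemO y).1 hy).2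
      have hxU : x ∈ U ∩ (W \ C) := mem_inter.2 ⟨heU x (Sym2.mem_mk_left _ _), hxΩ⟩
      have hOcard : O.card ≤ 1 := card_le_one.2 fun a ha b hb =>
        hW.unique a ((hmemO a).1 ha).1.1 b ((hmemO b).1 hb).1.1 ((hmemO a).1 ha).1.2
          ((hmemO b).1 hb).1.2
      have h2 : ((O.image fun y => s(x, y)).filter fun e => ∀ v ∈ e, v ∈ U).card ≤ 1 :=
        (card_filter_le _ _).trans (card_image_le.trans hOcard)
      have h3 := h1 hxU
      omega
    · rw [not_nonempty_iff_eq_empty.1 hO', card_empty]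
      omega
  · intro A hA
    -- `S` replaces `A` inside `W`. It contains `x` only if `x ∈ A` and the edge leaving `W` was
    -- kept; then `wt S₁ = wt S₀ + d` covers the `d` surplus caps left at `x`.
    obtain ⟨S, hSW, hS, hSA, hSx⟩ : ∃ S ⊆ W \ C, Indep G S ∧
        wt S₀ + ∑ v ∈ A ∩ (W \ C), m v ≤ wt S ∧ (x ∈ S ↔ x ∈ A ∧ ¬ wt S₁ < wt S₀) := by
      by_cases hx : x ∈ A ∧ ¬ wt S₁ < wt S₀
      · refine ⟨S₁, hS₁.1, hS₁.2.1, ?_, iff_of_true hS₁.2.2 hx⟩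
        have : ∑ v ∈ A ∩ (W \ C), m v ≤ d := by
          rw [hm, sum_ite_eq']
          split_ifs <;> simp
        omega
      · refine ⟨S₀, hS₀.1, hS₀.2.1, ?_, iff_of_false hS₀.2.2 hx⟩
        have : ∑ v ∈ A ∩ (W \ C), m v = 0 := by
          rw [hm, sum_ite_eq']
          split_ifs with h
          · have := not_and_not_right.1 hx (mem_inter.1 h).1
            omega
          · rfl
        omega
    obtain ⟨D, hDW, hSD, hDS, hD, hDcard⟩ := hW.exists_fill hC hSW hS
    have hAD : ∀ a ∈ A \ W, ∀ b ∈ D, ¬ G.Adj a b := by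
      intro a ha b hb hab
      obtain ⟨haA, haW⟩ := mem_sdiff.1 ha
      obtain ⟨rfl, haC⟩ := hW.edge b (hDW hb) a haW hab.symm
      rcases mem_union.1 (hDS hb) with hbS | hbC
      · obtain ⟨hbA, hlt⟩ := hSx.1 hbS
        exact hA b hbA a haA (SimpleGraph.deleteEdges_adj.2 ⟨hab.symm, fun h => hlt (hout a haW h)⟩)
      · exact hW.notMem hbC
    have hAW : Indep G (A \ W) := by
      refine indep_of_deleteEdges (hA.subset sdiff_subset) fun a ha b hb hab => ?_
      have haW := (mem_sdiff.1 ha).2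
      have hbW := (mem_sdiff.1 hb).2
      rcases (hmemL _).1 hab with ⟨v, hv, c, hc, h⟩ | ⟨y, hy, h⟩
      · rcases Sym2.eq_iff.1 h with ⟨rfl, -⟩ | ⟨rfl, -⟩
        · exact haW (mem_sdiff.1 hv).1
        · exact hbW (mem_sdiff.1 hv).1
      · rcases Sym2.eq_iff.1 h with ⟨rfl, -⟩ | ⟨rfl, -⟩
        · exact haW hW.mem
        · exact hbW hW.mem
    refine ⟨A \ W ∪ D, ?_, ?_⟩
    · intro a ha b hb hab
      rcases mem_union.1 ha with ha | ha <;> rcases mem_union.1 hb with hb | hb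
      · exact hAW a ha b hb hab
      · exact hAD a ha b hb hab
      · exact hAD b hb a ha hab.symm
      · exact hD a ha b hb hab
    have hin : (nbrs (G.deleteEdges L) A ∩ W).card ≤
        (W \ C).card + ∑ v ∈ A ∩ (W \ C), m v := by
      refine card_nbrs_inter_le (fun a ha b hb hab => hC.indep a ha b hb (hHG hab))
        (fun v hv y hy hvy => ?_) (fun v hv => ?_) hA
      · rw [(hW.edge v hv y hy (hHG hvy)).1]
        exact hW.notMem
      · have hsub : caps (G.deleteEdges (L : Set (Sym2 V))) C v ⊆ caps G C v \ R v := by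
          intro c hc
          obtain ⟨hcC, hvc⟩ := mem_caps.1 hc
          refine mem_sdiff.2 ⟨mem_caps.2 ⟨hcC, hHG hvc⟩, fun hcR => ?_⟩
          exact (SimpleGraph.deleteEdges_adj.1 hvc).2 ((hmemL _).2 (Or.inl ⟨v, hv, c, hcR, rfl⟩))
        have h1 := card_le_card hsub
        have h2 := card_sdiff_add_card_eq_card (hRsub v)
        have h3 := hRcard v
        have h4 := hmle v
        have h5 := hW.one_le_card_caps hv
        omega
    have hoff : nbrs (G.deleteEdges L) A \ W ⊆ nbrs G (A \ W ∪ D) \ W := by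
      intro y hy
      obtain ⟨hyN, hyW⟩ := mem_sdiff.1 hy
      refine mem_sdiff.2 ⟨?_, hyW⟩
      obtain ⟨a, ha, hay⟩ := mem_nbrs.1 hyN
      by_cases haW : a ∈ W
      · obtain ⟨rfl, hyC⟩ := hW.edge a haW y hyW (hHG hay)
        have hlt : ¬ wt S₁ < wt S₀ := fun hlt => (SimpleGraph.deleteEdges_adj.1 hay).2
          ((hmemL _).2 (Or.inr ⟨y, (hmemO y).2 ⟨⟨hyW, hHG hay⟩, hlt⟩, rfl⟩))
        exact mem_nbrs.2 ⟨a, mem_union_right _ (hSD (hSx.2 ⟨ha, hlt⟩)), hHG hay⟩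
      · exact mem_nbrs.2 ⟨a, mem_union_left _ (mem_sdiff.2 ⟨ha, haW⟩), hHG hay⟩
    have hin' : nbrs G D ∩ W ⊆ nbrs G (A \ W ∪ D) ∩ W :=
      inter_subset_inter_right (nbrs_mono le_rfl subset_union_right)
    have h1 := card_le_card hoff
    have h2 := card_le_card hin'
    have h3 := card_sdiff_add_card_inter (nbrs (G.deleteEdges (L : Set (Sym2 V))) A) W
    have h4 := card_sdiff_add_card_inter (nbrs G (A \ W ∪ D)) W
    have h5 : wt S = ∑ v ∈ S, ((caps G C v).card - 1) := rfl
    omega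

/-- In a finite forest one can find a vertex of degree at most one, avoiding a given vertex. -/
lemma exists_degree_le_one_of_isAcyclic {H : SimpleGraph V} (hH : H.IsAcyclic) {v₁ x : V}
    (h : v₁ ≠ x) : ∃ v, v ≠ x ∧ (v = v₁ ∨ ∃ y, H.Adj v y) ∧
      ∀ y y', H.Adj v y → H.Adj v y' → y = y' := by
  -- By acyclicity, an end of a longest path has only the next vertex of the path as neighbour, and
  -- one of the two ends differs from `x`. Length zero means that there are no edges, and `v₁`
  -- serves.
  let P : ℕ → Prop := fun n => ∃ (u w : V) (p : H.Walk u w), p.IsPath ∧ p.length = n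
  have hP0 : P 0 := ⟨x, x, .nil, by simp, rfl⟩
  obtain ⟨u, w, p, hp, hlen⟩ : P (Nat.findGreatest P (Fintype.card V)) :=
    Nat.findGreatest_spec (Nat.zero_le _) hP0
  have hmax : ∀ (u w : V) (q : H.Walk u w), q.IsPath → q.length ≤ p.length := fun u w q hq => by
    rw [hlen]
    exact Nat.le_findGreatest hq.length_lt.le ⟨u, w, q, hq, rfl⟩
  have hstart : ∀ {u w : V} (q : H.Walk u w), q.IsPath → q.length = p.length →
      ∀ y, H.Adj u y → y = q.snd := by
    intro u w q hq hql y huy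
    have hy : y ∈ q.support := by
      by_contra hy
      have h1 := hmax _ _ (.cons huy.symm q) ((SimpleGraph.Walk.cons_isPath_iff _ _).2 ⟨hq, hy⟩)
      rw [SimpleGraph.Walk.length_cons] at h1
      omega
    exact hH.eq_snd_of_adj_start hq huy hy
  by_cases hlen0 : p.length = 0
  · refine ⟨v₁, h, Or.inl rfl, fun y y' hy _ => ?_⟩
    have h1 := hmax _ _ hy.toWalk (by simpa using hy.ne)
    simp at h1
    omega
  · have hnil : ¬ p.Nil := fun h => hlen0 (SimpleGraph.Walk.length_eq_zero_iff.2 h)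
    by_cases hu : u = x
    · have hwx : w ≠ x := by
        rintro rfl
        subst hu
        exact hlen0 (SimpleGraph.Walk.length_eq_zero_iff.2 (SimpleGraph.Walk.isPath_iff_nil.1 hp))
      have hr := hstart p.reverse hp.reverse (by simp)
      exact ⟨w, hwx, Or.inr ⟨_, (p.adj_penultimate hnil).symm⟩,
        fun y y' hy hy' => (hr y hy).trans (hr y' hy').symm⟩
    · have hr := hstart p hp rfl
      exact ⟨u, hu, Or.inr ⟨_, p.adj_snd hnil⟩, fun y y' hy hy' => (hr y hy).trans (hr y' hy').symm⟩

/-- A cluster can be reduced unless `x` is its only vertex that is not a cap. -/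
lemma IsCluster.reducible_or (hC : IsCapSet G C) (hW : IsCluster G C W x)
    (hS : ∀ E, CycleEdges G E → SpecialEdges G E → ∃ e ∈ E, ∃ c ∈ C, c ∈ e) :
    Reducible G ∨ ∀ v ∈ W, v ∉ C → v = x := by
  by_cases hex : ∃ v ∈ W \ C, v ≠ x ∧ 2 ≤ (caps G C v).card
  · obtain ⟨v, hv, hvx, h2⟩ := hex
    exact Or.inl (hW.reducible_of_excess hC hv hvx h2)
  by_cases hone : ∀ v ∈ W, v ∉ C → v = x
  · exact Or.inr hone
  left
  push Not at hex hone
  obtain ⟨v₁, hv₁W, hv₁C, hv₁x⟩ := hone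
  have hcap : ∀ v ∈ W \ C, v ≠ x → ∃ c, caps G C v = {c} := fun v hv hvx =>
    card_eq_one.1 (le_antisymm (by have := hex v hv hvx; omega) (hW.one_le_card_caps hv))
  have hin : ∀ v ∈ W, v ≠ x → ∀ y, G.Adj v y → y ∈ W := by
    intro v hv hvx y hvy
    by_contra hy
    exact hvx (hW.edge v hv y hy hvy).1
  let H : SimpleGraph V :=
    { Adj := fun a b => G.Adj a b ∧ a ∈ W \ C ∧ b ∈ W \ C
      symm := ⟨fun a b h => ⟨h.1.symm, h.2.2, h.2.1⟩⟩
      loopless := ⟨fun a h => G.loopless.irrefl a h.1⟩ }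
  have hHG : H ≤ G := fun a b h => h.1
  -- Every vertex of `W \ C` except possibly `x` now has exactly one cap. In a forest, a vertex of
  -- degree at most one is reduced together with its cap; a cycle in `H` avoids all caps, so it is
  -- ordinary.
  by_cases hac : H.IsAcyclic
  · obtain ⟨v, hvx, hv, huniq⟩ := exists_degree_le_one_of_isAcyclic hac hv₁x
    have hvΩ : v ∈ W \ C := by
      rcases hv with rfl | ⟨y, hy⟩
      · exact mem_sdiff.2 ⟨hv₁W, hv₁C⟩
      · exact hy.2.1
    obtain ⟨hvW, hvC⟩ := mem_sdiff.1 hvΩ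
    obtain ⟨c, hc⟩ := hcap v hvΩ hvx
    have hcv : c ∈ caps G C v := by simp [hc]
    obtain ⟨hcC, hvc⟩ := mem_caps.1 hcv
    have hnb : ∀ y, G.Adj v y → H.Adj v y ∨ y = c := by
      intro y hvy
      by_cases hyC : y ∈ C
      · exact Or.inr (by simpa [hc] using mem_caps.2 ⟨hyC, hvy⟩)
      · exact Or.inl ⟨hvy, hvΩ, mem_sdiff.2 ⟨hin v hvW hvx y hvy, hyC⟩⟩
    have hcnb : ∀ y, G.Adj c y → y = v ∨ H.Adj v y := by
      intro y hcy
      by_cases hyv : y = v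
      · exact Or.inl hyv
      · refine Or.inr ((hnb y (hC.clique c hcC v y hvc.symm hcy (Ne.symm hyv))).resolve_right ?_)
        rintro rfl
        exact G.loopless.irrefl _ hcy
    by_cases hiso : ∃ v', H.Adj v v'
    · obtain ⟨v', hvv'⟩ := hiso
      obtain ⟨c', hc'C, hvc'⟩ := hW.capped v' (mem_sdiff.1 hvv'.2.2).1 (mem_sdiff.1 hvv'.2.2).2
      refine reducible_of_adjacent_caps (hHG hvv') hvc (fun y hy => ?_) (fun y hy => ?_) hvc'
        (fun y hy hne => hC.clique c' hc'C v' y hvc'.symm hy hne.symm) ?_ ?_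
      · exact (hnb y hy).imp_left fun h => huniq y v' h hvv'
      · exact (hcnb y hy).imp_right fun h => huniq y v' h hvv'
      · rintro rfl
        exact hvC hc'C
      · rintro rfl
        exact (mem_sdiff.1 hvv'.2.2).2 hcC
    · push Not at hiso
      refine reducible_of_star hvc fun y hy w hw => ?_
      obtain rfl := (hnb y hy).resolve_left (hiso y)
      exact (hcnb w hw).resolve_right (hiso w)
  · unfold SimpleGraph.IsAcyclic at hac
    push Not at hac
    obtain ⟨r, p, hp⟩ := hac
    obtain ⟨a, b, heE, hax⟩ : ∃ a b, s(a, b) ∈ p.edgeSet ∧ a ≠ x := by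
      have h := p.mk_start_snd_mem_edges hp.not_nil
      by_cases hr : r = x
      · refine ⟨p.snd, r, ?_, fun h' => ?_⟩
        · rw [Sym2.eq_swap]
          exact h
        · exact (p.adj_snd hp.not_nil).ne (hr.trans h'.symm)
      · exact ⟨r, p.snd, h, hr⟩
    have hE : CycleEdges G p.edgeSet :=
      ⟨r, p.mapLe hHG, hp.mapLe hHG, by ext e; simp [SimpleGraph.Walk.edgeSet]⟩
    have hns : ¬ SpecialEdges G p.edgeSet := by
      intro hs
      obtain ⟨e, he, c, hc, hce⟩ := hS _ hE hs
      have heH : e ∈ H.edgeSet := p.edges_subset_edgeSet he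
      induction e with
      | _ a b =>
        have h : H.Adj a b := heH
        rcases Sym2.mem_iff.1 hce with rfl | rfl
        · exact (mem_sdiff.1 h.2.1).2 hc
        · exact (mem_sdiff.1 h.2.2).2 hc
    have hab : H.Adj a b := p.edges_subset_edgeSet heE
    obtain ⟨haW, haC⟩ := mem_sdiff.1 hab.2.1
    obtain ⟨c, hc⟩ := hcap a hab.2.1 hax
    refine reducible_of_cycle_edge hE hns heE
      (hC.dom_deleteEdges_singleton (u' := c) (fun y hy _ hyc => ?_) (hHG hab))
    refine hW.capped y (hin a haW hax y hy) fun hyC => hyc ?_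
    simpa [hc] using mem_caps.2 ⟨hyC, hy⟩

end Clusters

/-! ### Special cycles of length at least 6 -/

section Threads

variable {V : Type*} {G : SimpleGraph V}

/-- A cycle `c 0, …, c (3 * m + 2)` in which only the adjacent vertices `c 0` and
`c (3 * m + 2)` may have neighbours outside the cycle. -/
structure IsThread (G : SimpleGraph V) (m : ℕ) (c : ℕ → V) : Prop where
  inj : ∀ i ≤ 3 * m + 2, ∀ j ≤ 3 * m + 2, c i = c j → i = j
  adj : ∀ i ≤ 3 * m + 1, G.Adj (c i) (c (i + 1))
  close : G.Adj (c 0) (c (3 * m + 2))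
  deg : ∀ i ≤ 3 * m, ∀ y, G.Adj (c (i + 1)) y → y = c i ∨ y = c (i + 2)

/-- Start the cycle at `a` and orient it so that `b` comes last. -/
lemma SpecialEdges.exists_isThread [Finite V] {E : Set (Sym2 V)} (hE : SpecialEdges G E) :
    ∃ m c, IsThread G m c ∧ ∀ v, (∃ e ∈ E, v ∈ e) ↔ ∃ i ≤ 3 * m + 2, v = c i := by
  obtain ⟨r, p, hp, rfl, h3, a, b, hab, hdeg⟩ := hE
  have ha : a ∈ p.support := (mem_support_iff_of_isCycle hp a).2 ⟨_, hab, Sym2.mem_mk_left _ _⟩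
  obtain ⟨q, hq, hqlen, hqe, hqb⟩ : ∃ q : G.Walk a a, q.IsCycle ∧ q.length = p.length ∧
      q.edgeSet = p.edgeSet ∧ b = q.penultimate := by
    have hrot : (p.rotate a ha).edgeSet = p.edgeSet := by
      ext e
      exact (p.rotate_edges a ha).perm.mem_iff
    have hcyc : (p.rotate a ha).IsCycle := by simpa using hp
    have hb : b ∈ (p.rotate a ha).toSubgraph.neighborSet a := by
      rw [SimpleGraph.Subgraph.mem_neighborSet, ← SimpleGraph.Subgraph.mem_edgeSet,
        SimpleGraph.Walk.edgeSet_toSubgraph, hrot]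
      exact hab
    rw [hcyc.neighborSet_toSubgraph_endpoint] at hb
    rcases hb with hb | hb
    · refine ⟨(p.rotate a ha).reverse, hcyc.reverse, by simp, ?_, by simpa using hb⟩
      rw [← hrot]
      ext e
      simp [SimpleGraph.Walk.edgeSet]
    · exact ⟨p.rotate a ha, hcyc, by simp, hrot, hb⟩
  have hlen3 := hq.three_le_length
  obtain ⟨m, hm⟩ : ∃ m, q.length = 3 * m + 3 := by
    obtain ⟨k, hk⟩ := h3
    exact ⟨k - 1, by omega⟩
  have hb : b = q.getVert (3 * m + 2) := by
    rw [hqb]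
    simp only [SimpleGraph.Walk.penultimate, hm]
    rfl
  have ha0 : a = q.getVert 0 := by simp
  have hsupp : ∀ w, w ∈ q.support ↔ w ∈ p.support := fun w => by
    rw [mem_support_iff_of_isCycle hq, mem_support_iff_of_isCycle hp, hqe]
  have hinj : ∀ i ≤ 3 * m + 2, ∀ j ≤ 3 * m + 2, q.getVert i = q.getVert j → i = j := by
    intro i hi j hj h
    refine hq.getVert_injOn' ?_ ?_ h
    · show i ≤ q.length - 1
      omega
    · show j ≤ q.length - 1
      omega
  refine ⟨m, q.getVert, ⟨hinj, ?_, ?_, ?_⟩, ?_⟩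
  · intro i hi
    exact q.adj_getVert_succ (by omega)
  · rw [← hb, ← ha0, hqb]
    exact (q.adj_penultimate hq.not_nil).symm
  · intro i hi y hy
    have hset := hq.neighborSet_toSubgraph_internal (i := i + 1) (by omega) (by omega)
    have hmem : q.getVert (i + 1) ∈ q.support := q.getVert_mem_support _
    have h2 := hq.ncard_neighborSet_toSubgraph_eq_two hmem
    have hd := hdeg (q.getVert (i + 1)) ((hsupp _).1 hmem) (fun h => by
        have := hinj (i + 1) (by omega) 0 (by omega) (h.trans ha0)
        omega) (fun h => by
        have := hinj (i + 1) (by omega) (3 * m + 2) (by omega) (h.trans hb)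
        omega)
    have heq : q.toSubgraph.neighborSet (q.getVert (i + 1)) = G.neighborSet (q.getVert (i + 1)) :=
      Set.eq_of_subset_of_ncard_le (q.toSubgraph.neighborSet_subset _) (by rw [h2, hd])
        (Set.toFinite _)
    have hy' : y ∈ G.neighborSet (q.getVert (i + 1)) := hy
    rw [← heq, hset] at hy'
    simpa using hy'
  · intro v
    rw [← hqe, ← mem_support_iff_of_isCycle hq, SimpleGraph.Walk.mem_support_iff_exists_getVert]
    constructor
    · rintro ⟨i, rfl, hi⟩
      by_cases h : i ≤ 3 * m + 2
      · exact ⟨i, h, rfl⟩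
      · refine ⟨0, by omega, ?_⟩
        rw [show i = q.length by omega]
        simp
    · rintro ⟨i, hi, rfl⟩
      exact ⟨i, rfl, by omega⟩

/-- The class of `0` contains both ends of the range, hence one element more than those of `1` and
`2`. -/
lemma card_filter_mod_three (m r : ℕ) :
    2 * m + (if r = 0 then 0 else 1) ≤ ((range (3 * m + 1)).filter fun i => i % 3 ≠ r).card := by
  induction m with
  | zero =>
    split_ifs with h
    · simp
    · simp [Ne.symm h, filter_singleton]
  | succ m ih =>
    rw [card_filter] at ih ⊢
    rw [show 3 * (m + 1) + 1 = 3 * m + 1 + 1 + 1 + 1 by ring, sum_range_succ, sum_range_succ,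
      sum_range_succ]
    have h1 : (3 * m + 1) % 3 = 1 := by omega
    have h2 : (3 * m + 1 + 1) % 3 = 2 := by omega
    have h3 : (3 * m + 1 + 1 + 1) % 3 = 0 := by omega
    rw [h1, h2, h3]
    split_ifs at ih ⊢ <;> omega

variable [Fintype V]

/-- The deleted edges form `m` pairs, each joined by a surviving edge, so each pair costs one. The
inner vertices then span just these `m` joining edges, and `A` has at most `m` inner neighbours, or
`m + 1` if an end `c 0` or `c (3 * m + 2)` lies in `A`. In `G`, every third inner vertex, in phase
with that end, dominates all other inner vertices: `m` more. -/
lemma IsThread.reducible {m : ℕ} {c : ℕ → V} (hc : IsThread G m c) (hm : 1 ≤ m) :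
    Reducible G := by
  set L : Finset (Sym2 V) := (range m).biUnion fun j =>
    {s(c (3 * j + 1), c (3 * j + 2)), s(c (3 * j + 3), c (3 * j + 4))} with hL
  have hmemL : ∀ e : Sym2 V, e ∈ (L : Set (Sym2 V)) ↔ ∃ j < m,
      e = s(c (3 * j + 1), c (3 * j + 2)) ∨ e = s(c (3 * j + 3), c (3 * j + 4)) := by
    intro e
    simp [hL]
  have hidx : ∀ p ≤ 3 * m + 2, ∀ q ≤ 3 * m + 2, s(c p, c q) ∈ (L : Set (Sym2 V)) →
      ∃ j < m, (p = 3 * j + 1 ∧ q = 3 * j + 2) ∨ (p = 3 * j + 2 ∧ q = 3 * j + 1) ∨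
        (p = 3 * j + 3 ∧ q = 3 * j + 4) ∨ (p = 3 * j + 4 ∧ q = 3 * j + 3) := by
    intro p hp q hq h
    obtain ⟨j, hj, h | h⟩ := (hmemL _).1 h <;> refine ⟨j, hj, ?_⟩ <;>
      rcases Sym2.eq_iff.1 h with ⟨h1, h2⟩ | ⟨h1, h2⟩
    · exact Or.inl ⟨hc.inj _ hp _ (by omega) h1, hc.inj _ hq _ (by omega) h2⟩
    · exact Or.inr (Or.inl ⟨hc.inj _ hp _ (by omega) h1, hc.inj _ hq _ (by omega) h2⟩)
    · exact Or.inr (Or.inr (Or.inl ⟨hc.inj _ hp _ (by omega) h1, hc.inj _ hq _ (by omega) h2⟩))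
    · exact Or.inr (Or.inr (Or.inr ⟨hc.inj _ hp _ (by omega) h1, hc.inj _ hq _ (by omega) h2⟩))
  have hHG := G.deleteEdges_le (L : Set (Sym2 V))
  have hlink : ∀ j < m, (G.deleteEdges (L : Set (Sym2 V))).Adj (c (3 * j + 2)) (c (3 * j + 3)) := by
    intro j hj
    refine SimpleGraph.deleteEdges_adj.2 ⟨hc.adj (3 * j + 2) (by omega), fun h => ?_⟩
    obtain ⟨i, hi, h⟩ := hidx _ (by omega) _ (by omega) h
    omega
  have hclose : (G.deleteEdges (L : Set (Sym2 V))).Adj (c 0) (c (3 * m + 2)) := by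
    refine SimpleGraph.deleteEdges_adj.2 ⟨hc.close, fun h => ?_⟩
    obtain ⟨i, hi, h⟩ := hidx _ (by omega) _ (by omega) h
    omega
  refine reducible_of_dom (L := L) (t := m) ?_ ?_ ?_ ?_
  · exact ⟨s(c 1, c 2), (hmemL _).2 ⟨0, hm, Or.inl rfl⟩⟩
  · intro e he
    obtain ⟨j, hj, rfl | rfl⟩ := (hmemL e).1 he
    · exact hc.adj (3 * j + 1) (by omega)
    · exact hc.adj (3 * j + 3) (by omega)
  · intro U hU
    rw [hL, filter_biUnion]
    refine card_biUnion_le.trans ?_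
    refine (sum_le_card_nsmul _ _ 1 fun j hj => ?_).trans (by simp)
    exact card_filter_pair_le hU (Sym2.mem_mk_right _ _) (Sym2.mem_mk_left _ _)
      (hlink j (mem_range.1 hj))
  intro A hA
  set P : Finset V := (range (3 * m + 1)).image fun i => c (i + 1) with hPdef
  have hP : ∀ y, y ∈ P ↔ ∃ i < 3 * m + 1, c (i + 1) = y := by simp [hPdef]
  have h0P : c 0 ∉ P := by
    intro h
    obtain ⟨i, hi, h⟩ := (hP _).1 h
    have := hc.inj _ (by omega) _ (by omega) h
    omega
  have h2P : c (3 * m + 2) ∉ P := by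
    intro h
    obtain ⟨i, hi, h⟩ := (hP _).1 h
    have := hc.inj _ (by omega) _ (by omega) h
    omega
  -- In the indexing `c (i + 1)` the ends sit at `i = -1` and `i = 3 * m + 1`, of residues 2 and 1.
  -- The surviving closing edge keeps `A` from containing both.
  obtain ⟨r, hr, hr0, hr1, hr2⟩ : ∃ r < 3, (r = 0 → c 0 ∉ A ∧ c (3 * m + 2) ∉ A) ∧
      (r = 1 → c 0 ∉ A ∧ c (3 * m + 2) ∈ A) ∧ (r = 2 → c 0 ∈ A ∧ c (3 * m + 2) ∉ A) := by
    by_cases h0 : c 0 ∈ A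
    · exact ⟨2, by simp, by simp, by simp, fun _ => ⟨h0, fun h => hA _ h0 _ h hclose⟩⟩
    · by_cases h2 : c (3 * m + 2) ∈ A
      · exact ⟨1, by simp, by simp, fun _ => ⟨h0, h2⟩, by simp⟩
      · exact ⟨0, by simp, fun _ => ⟨h0, h2⟩, by simp, by simp⟩
  set D : Finset V := ((range (3 * m + 1)).filter fun i => i % 3 = r).image fun i => c (i + 1)
    with hDdef
  have hD : ∀ y, y ∈ D ↔ ∃ i < 3 * m + 1, i % 3 = r ∧ c (i + 1) = y := by
    simp [hDdef, and_assoc]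
  have hDD : ∀ a ∈ D, ∀ b ∈ A \ P ∪ D, ¬ G.Adj a b := by
    intro a ha b hb hab
    obtain ⟨i, hi, hir, rfl⟩ := (hD a).1 ha
    have hb' := hc.deg i (by omega) b hab
    rcases mem_union.1 hb with hb | hb
    · obtain ⟨hbA, hbP⟩ := mem_sdiff.1 hb
      rcases hb' with rfl | rfl
      · obtain rfl : i = 0 := by
          by_contra hi0
          exact hbP ((hP _).2 ⟨i - 1, by omega, by rw [Nat.sub_add_cancel (by omega)]⟩)
        exact (hr0 (by omega)).1 hbA
      · obtain rfl : i = 3 * m := by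
          by_contra hi0
          exact hbP ((hP _).2 ⟨i + 1, by omega, rfl⟩)
        exact (hr0 (by omega)).2 hbA
    · obtain ⟨j, hj, hjr, rfl⟩ := (hD b).1 hb
      rcases hb' with h | h
      · have := hc.inj _ (by omega) _ (by omega) h
        omega
      · have := hc.inj _ (by omega) _ (by omega) h
        omega
  have hAP : Indep G (A \ P) := by
    refine indep_of_deleteEdges (hA.subset sdiff_subset) fun a ha b hb hab => ?_
    have haP := (mem_sdiff.1 ha).2
    have hbP := (mem_sdiff.1 hb).2
    obtain ⟨j, hj, h | h⟩ := (hmemL _).1 hab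
    · have h1 : c (3 * j + 1) ∈ P := (hP _).2 ⟨3 * j, by omega, rfl⟩
      rcases Sym2.eq_iff.1 h with ⟨rfl, -⟩ | ⟨-, rfl⟩
      · exact haP h1
      · exact hbP h1
    · have h1 : c (3 * j + 3) ∈ P := (hP _).2 ⟨3 * j + 2, by omega, rfl⟩
      rcases Sym2.eq_iff.1 h with ⟨rfl, -⟩ | ⟨-, rfl⟩
      · exact haP h1
      · exact hbP h1
  refine ⟨A \ P ∪ D, ?_, ?_⟩
  · intro a ha b hb hab
    rcases mem_union.1 ha with ha' | ha'
    · rcases mem_union.1 hb with hb' | hb'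
      · exact hAP a ha' b hb' hab
      · exact hDD b hb' a ha hab.symm
    · exact hDD a ha' b hb hab
  have hin : 2 * m + (if r = 0 then 0 else 1) ≤ (nbrs G (A \ P ∪ D) ∩ P).card := by
    refine (card_filter_mod_three m r).trans ?_
    rw [← card_image_of_injOn (f := fun i => c (i + 1)) (s := (range (3 * m + 1)).filter _)]
    · refine card_le_card fun y hy => ?_
      obtain ⟨i, hi, rfl⟩ := mem_image.1 hy
      obtain ⟨hi, hir⟩ := mem_filter.1 hi
      have hi := mem_range.1 hi
      refine mem_inter.2 ⟨?_, (hP _).2 ⟨i, hi, rfl⟩⟩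
      by_cases hprev : (i + 2) % 3 = r
      · refine mem_nbrs.2 ⟨c i, ?_, hc.adj i (by omega)⟩
        by_cases hi0 : i = 0
        · subst hi0
          exact mem_union_left _ (mem_sdiff.2 ⟨(hr2 (by omega)).1, h0P⟩)
        · exact mem_union_right _ ((hD _).2 ⟨i - 1, by omega, by omega,
            by rw [Nat.sub_add_cancel (by omega)]⟩)
      · refine mem_nbrs.2 ⟨c (i + 2), ?_, (hc.adj (i + 1) (by omega)).symm⟩
        by_cases hi0 : i = 3 * m
        · subst hi0
          exact mem_union_left _ (mem_sdiff.2 ⟨(hr1 (by omega)).2, h2P⟩)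
        · exact mem_union_right _ ((hD _).2 ⟨i + 1, by omega, by omega, rfl⟩)
    · intro i hi j hj hij
      have hi' := mem_range.1 (mem_filter.1 hi).1
      have hj' := mem_range.1 (mem_filter.1 hj).1
      have := hc.inj _ (by omega) _ (by omega) hij
      omega
  have hinA : (nbrs (G.deleteEdges L) A ∩ P).card ≤ m + (if r = 0 then 0 else 1) := by
    have hsub : nbrs (G.deleteEdges L) A ∩ P ⊆
        (range m).image (fun j => if c (3 * j + 2) ∈ A then c (3 * j + 3) else c (3 * j + 2)) ∪
        (if r = 0 then ∅ else {if r = 2 then c 1 else c (3 * m + 1)}) := by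
      intro y hy
      obtain ⟨hyN, hyP⟩ := mem_inter.1 hy
      obtain ⟨i, hi, rfl⟩ := (hP y).1 hyP
      obtain ⟨a, ha, hay⟩ := mem_nbrs.1 hyN
      have hayG := hHG hay
      have hayL := (SimpleGraph.deleteEdges_adj.1 hay).2
      obtain ⟨j, hj⟩ : ∃ j, i = 3 * j ∨ i = 3 * j + 1 ∨ i = 3 * j + 2 := ⟨i / 3, by omega⟩
      rcases hj with rfl | rfl | rfl
      · refine mem_union_right _ ?_
        rcases hc.deg _ (by omega) a hayG.symm with rfl | rfl
        · by_cases hj0 : j = 0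
          · subst hj0
            have : r = 2 := by
              have h1 : r ≠ 0 := fun h => (hr0 h).1 ha
              have h2 : r ≠ 1 := fun h => (hr1 h).1 ha
              omega
            simp [this]
          · refine (hayL ((hmemL _).2 ⟨j - 1, by omega, Or.inr ?_⟩)).elim
            rw [show 3 * (j - 1) + 3 = 3 * j by omega, show 3 * (j - 1) + 4 = 3 * j + 1 by omega]
        · by_cases hjm : j = m
          · subst hjm
            have : r = 1 := by
              have h1 : r ≠ 0 := fun h => (hr0 h).2 ha
              have h2 : r ≠ 2 := fun h => (hr2 h).2 ha
              omega
            simp [this]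
          · exact (hayL ((hmemL _).2 ⟨j, by omega, Or.inl Sym2.eq_swap⟩)).elim
      · have hjm : j < m := by omega
        refine mem_union_left _ (mem_image.2 ⟨j, mem_range.2 hjm, ?_⟩)
        rcases hc.deg _ (by omega) a hayG.symm with rfl | rfl
        · exact (hayL ((hmemL _).2 ⟨j, hjm, Or.inl rfl⟩)).elim
        · exact if_neg fun h => hA _ h _ ha (hlink j hjm)
      · have hjm : j < m := by omega
        refine mem_union_left _ (mem_image.2 ⟨j, mem_range.2 hjm, ?_⟩)
        rcases hc.deg _ (by omega) a hayG.symm with rfl | rfl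
        · exact if_pos ha
        · exact (hayL ((hmemL _).2 ⟨j, hjm, Or.inr Sym2.eq_swap⟩)).elim
    refine (card_le_card hsub).trans ((card_union_le _ _).trans (add_le_add ?_ ?_))
    · exact card_image_le.trans (by simp)
    · split_ifs <;> simp
  -- An end dominated from inside stays dominated, by the other end if that is in `A`; otherwise `r
  -- = 0` and `D` contains both `c 1` and `c (3 * m + 1)`.
  have hoff : nbrs (G.deleteEdges L) A \ P ⊆ nbrs G (A \ P ∪ D) \ P := by
    intro y hy
    obtain ⟨hyN, hyP⟩ := mem_sdiff.1 hy
    have hyA := hA.notMem_of_mem_nbrs hyN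
    refine mem_sdiff.2 ⟨?_, hyP⟩
    obtain ⟨a, ha, hay⟩ := mem_nbrs.1 hyN
    by_cases haP : a ∈ P
    · obtain ⟨i, hi, rfl⟩ := (hP a).1 haP
      rcases hc.deg i (by omega) y (hHG hay) with rfl | rfl
      · obtain rfl : i = 0 := by
          by_contra hi0
          exact hyP ((hP _).2 ⟨i - 1, by omega, by rw [Nat.sub_add_cancel (by omega)]⟩)
        by_cases hb : c (3 * m + 2) ∈ A
        · exact mem_nbrs.2 ⟨_, mem_union_left _ (mem_sdiff.2 ⟨hb, h2P⟩), hc.close.symm⟩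
        · have : r = 0 := by
            have h1 : r ≠ 1 := fun h => hb (hr1 h).2
            have h2 : r ≠ 2 := fun h => hyA (hr2 h).1
            omega
          exact mem_nbrs.2 ⟨c 1, mem_union_right _ ((hD _).2 ⟨0, by omega, by omega, rfl⟩),
            (hc.adj 0 (by omega)).symm⟩
      · obtain rfl : i = 3 * m := by
          by_contra hi0
          exact hyP ((hP _).2 ⟨i + 1, by omega, rfl⟩)
        by_cases hb : c 0 ∈ A
        · exact mem_nbrs.2 ⟨_, mem_union_left _ (mem_sdiff.2 ⟨hb, h0P⟩), hc.close⟩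
        · have : r = 0 := by
            have h1 : r ≠ 2 := fun h => hb (hr2 h).1
            have h2 : r ≠ 1 := fun h => hyA (hr1 h).2
            omega
          exact mem_nbrs.2 ⟨c (3 * m + 1),
            mem_union_right _ ((hD _).2 ⟨3 * m, by omega, by omega, rfl⟩), hc.adj _ (by omega)⟩
    · exact mem_nbrs.2 ⟨a, mem_union_left _ (mem_sdiff.2 ⟨ha, haP⟩), hHG hay⟩
  have h1 := card_le_card hoff
  have h3 := card_sdiff_add_card_inter (nbrs (G.deleteEdges (L : Set (Sym2 V))) A) P
  have h4 := card_sdiff_add_card_inter (nbrs G (A \ P ∪ D)) P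
  omega

end Threads

/-! ### Connectivity after removing a vertex -/

section Separation

variable {V : Type*} {G : SimpleGraph V}

/-- The graph with all edges at `z` deleted. -/
def avoid (G : SimpleGraph V) (z : V) : SimpleGraph V :=
  G.deleteEdges {e | z ∈ e}

lemma avoid_adj {z a b : V} : (avoid G z).Adj a b ↔ G.Adj a b ∧ z ≠ a ∧ z ≠ b := by
  simp [avoid]

lemma avoid_le (z : V) : avoid G z ≤ G := G.deleteEdges_le _

lemma reachable_avoid {z a b : V} (p : G.Walk a b) (h : z ∉ p.support) :
    (avoid G z).Reachable a b := by
  refine ⟨p.transfer _ fun e he => ?_⟩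
  rw [avoid, SimpleGraph.edgeSet_deleteEdges]
  exact ⟨p.edges_subset_edgeSet he, fun hz => h (p.mem_support_of_mem_edges he hz)⟩

lemma exists_path_of_reachable_avoid {z a b : V} (h : (avoid G z).Reachable a b) (ha : a ≠ z) :
    ∃ p : G.Walk a b, p.IsPath ∧ z ∉ p.support := by
  obtain ⟨p, hp⟩ := h.exists_isPath
  refine ⟨p.mapLe (avoid_le z), hp.mapLe _, fun hz => ?_⟩
  rw [SimpleGraph.Walk.support_mapLe_eq_support] at hz
  by_cases hnil : p.Nil
  · rw [SimpleGraph.Walk.nil_iff_support_eq.1 hnil, List.mem_singleton] at hz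
    exact ha hz.symm
  · obtain ⟨e, he, hze⟩ := (SimpleGraph.Walk.mem_support_iff_exists_mem_edges_of_not_nil hnil).1 hz
    have := p.edges_subset_edgeSet he
    rw [avoid, SimpleGraph.edgeSet_deleteEdges] at this
    exact this.2 hze

/-- Two neighbours of `z` that are connected outside `z` lie on a cycle through `z`. -/
lemma exists_cycle_of_reachable_avoid {z u u' : V} (hu : G.Adj z u) (hu' : G.Adj z u')
    (hne : u ≠ u') (h : (avoid G z).Reachable u u') :
    ∃ p : G.Walk z z, p.IsCycle ∧ s(z, u) ∈ p.edgeSet ∧ s(z, u') ∈ p.edgeSet ∧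
      ∀ y, s(z, y) ∈ p.edgeSet → y = u ∨ y = u' := by
  obtain ⟨q, hq, hz⟩ := exists_path_of_reachable_avoid h hu.ne'
  have hedges : ∀ e, e ∈ (SimpleGraph.Walk.cons hu (q.concat hu'.symm)).edgeSet ↔
      e = s(z, u) ∨ e ∈ q.edges ∨ e = s(z, u') := by
    intro e
    simp [SimpleGraph.Walk.edgeSet, SimpleGraph.Walk.edges_concat, Sym2.eq_swap (a := u')]
  have hzq : ∀ y, s(z, y) ∉ q.edges := fun y hy =>
    hz (q.mem_support_of_mem_edges hy (Sym2.mem_mk_left _ _))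
  refine ⟨.cons hu (q.concat hu'.symm), ?_, (hedges _).2 (Or.inl rfl),
    (hedges _).2 (Or.inr (Or.inr rfl)), fun y hy => ?_⟩
  · rw [SimpleGraph.Walk.cons_isCycle_iff]
    refine ⟨hq.concat hz _, fun hmem => ?_⟩
    rw [SimpleGraph.Walk.edges_concat, List.concat_eq_append, List.mem_append] at hmem
    rcases hmem with h | h
    · exact hzq u h
    · rw [List.mem_singleton] at h
      rcases Sym2.eq_iff.1 h with ⟨h, -⟩ | ⟨-, h⟩
      · exact hu'.ne h
      · exact hne h
  · rcases (hedges _).1 hy with h | h | h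
    · exact Or.inl (Sym2.congr_right.1 h)
    · exact (hzq y h).elim
    · exact Or.inr (Sym2.congr_right.1 h)

/-- Three such neighbours would give two distinct cycles sharing `z` and `u₁`. -/
lemma EdgeCactus.eq_or_eq_of_reachable_avoid (hG : EdgeCactus G) {z u₁ u₂ u₃ : V}
    (h₁ : G.Adj z u₁) (h₂ : G.Adj z u₂) (h₃ : G.Adj z u₃) (h12 : u₁ ≠ u₂)
    (hr₂ : (avoid G z).Reachable u₁ u₂) (hr₃ : (avoid G z).Reachable u₁ u₃) :
    u₃ = u₁ ∨ u₃ = u₂ := by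
  by_contra! hne
  obtain ⟨p, hp, hp1, hp2, hp3⟩ := exists_cycle_of_reachable_avoid h₁ h₂ h12 hr₂
  obtain ⟨q, hq, hq1, hq2, hq3⟩ := exists_cycle_of_reachable_avoid h₁ h₃ hne.1.symm hr₃
  have hpq : p.edgeSet ≠ q.edgeSet := by
    intro h
    rw [← h] at hq2
    rcases hp3 _ hq2 with h | h
    · exact hne.1 h
    · exact hne.2 h
  exact h₁.ne (hG p q hp hq hpq z u₁ p.start_mem_support
    (p.mem_support_of_mem_edges hp1 (Sym2.mem_mk_right _ _)) q.start_mem_support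
    (q.mem_support_of_mem_edges hq1 (Sym2.mem_mk_right _ _)))

/-- In a special triangle the neighbourhood of `c 1` is a clique, so `c 1` is a cap or one of its
two neighbours is. -/
lemma IsThread.exists_cap {C : Finset V} {c : ℕ → V} (hc : IsThread G 0 c)
    (hsimp : ∀ v, (∀ a b, G.Adj v a → G.Adj v b → a ≠ b → G.Adj a b) → v ∈ C ∨ Capped G C v) :
    ∃ x ∈ C, (∃ i ≤ 2, x = c i) ∧ ∀ v, (∃ i ≤ 2, v = c i) → v = x ∨ G.Adj v x := by
  have h01 : G.Adj (c 0) (c 1) := hc.adj 0 (by omega)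
  have h12 : G.Adj (c 1) (c 2) := hc.adj 1 (by omega)
  have h02 : G.Adj (c 0) (c 2) := hc.close
  have hdeg : ∀ y, G.Adj (c 1) y → y = c 0 ∨ y = c 2 := hc.deg 0 (by omega)
  have hx : ∃ x ∈ C, ∃ i ≤ 2, x = c i := by
    rcases hsimp (c 1) (fun a b ha hb hab => by
      rcases hdeg a ha with rfl | rfl <;> rcases hdeg b hb with rfl | rfl
      · exact (hab rfl).elim
      · exact h02
      · exact h02.symm
      · exact (hab rfl).elim) with h | ⟨y, hy, hay⟩
    · exact ⟨c 1, h, 1, by omega, rfl⟩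
    · rcases hdeg y hay with rfl | rfl
      · exact ⟨c 0, hy, 0, by omega, rfl⟩
      · exact ⟨c 2, hy, 2, by omega, rfl⟩
  obtain ⟨x, hxC, i, hi, rfl⟩ := hx
  refine ⟨c i, hxC, ⟨i, hi, rfl⟩, ?_⟩
  rintro v ⟨j, hj, rfl⟩
  interval_cases i <;> interval_cases j <;>
    simp [h01, h01.symm, h12, h12.symm, h02, h02.symm]

end Separation

/-! ### Every cactus with an edge is reducible -/

section Main

variable {V : Type*} [Fintype V] {G : SimpleGraph V}

/-- There is a set of caps such that a vertex whose neighbourhood is a clique is a cap or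
capped. -/
lemma exists_isCapSet (G : SimpleGraph V) : ∃ C, IsCapSet G C ∧
    ∀ v, (∀ a b, G.Adj v a → G.Adj v b → a ≠ b → G.Adj a b) → v ∈ C ∨ Capped G C v := by
  obtain ⟨C, hC, hmax⟩ := exists_max_image
    (univ.filter fun C : Finset V => IsCapSet G C) card
    ⟨∅, mem_filter.2 ⟨mem_univ _, ⟨indep_empty, by simp⟩⟩⟩
  simp only [mem_filter, mem_univ, true_and] at hC hmax
  refine ⟨C, hC, fun v hv => ?_⟩
  by_contra! hne
  have hvC : ∀ y ∈ C, ¬ G.Adj v y := fun y hy hvy => hne.2 ⟨y, hy, hvy⟩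
  have := hmax (insert v C) ⟨indep_insert hC.indep hvC, fun c hc => by
    rcases mem_insert.1 hc with rfl | hc
    · exact hv
    · exact hC.clique c hc⟩
  rw [card_insert_of_notMem hne.1] at this
  omega

/-- A graph without bare vertices is reducible. -/
lemma IsCapSet.reducible_of_forall_capped {C : Finset V} (hC : IsCapSet G C)
    (hS : ∀ E, CycleEdges G E → SpecialEdges G E → ∃ e ∈ E, ∃ c ∈ C, c ∈ e)
    (hcap : ∀ v, v ∉ C → Capped G C v) (hne : G.edgeSet.Nonempty) : Reducible G := by
  obtain ⟨x, hx⟩ : ∃ x, x ∉ C := by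
    obtain ⟨e, he⟩ := hne
    induction e with
    | _ a b =>
      by_contra! h
      exact hC.indep a (h a) b (h b) he
  have hW : IsCluster G C univ x :=
    ⟨mem_univ _, hx, by simp, by simp, fun v _ hv => hcap v hv⟩
  rcases hW.reducible_or hC hS with h | h
  · exact h
  have hcore : ∀ v, v ∉ C → v = x := fun v => h v (mem_univ v)
  obtain ⟨l, hl, hxl⟩ := hcap x hx
  refine reducible_of_star hxl fun y hxy w hyw => ?_
  have hy : y ∈ C := by
    by_contra hy
    exact hxy.ne (hcore y hy).symm
  exact hcore w fun hw => hC.indep y hy w hw hyw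

/-- A bare vertex that leaves all other bare vertices of its component on one side. -/
lemma exists_extremal_bare {p : V → Prop} {r : V} (hr : p r) :
    ∃ z, p z ∧ G.Reachable r z ∧
      ∀ y, p y → y ≠ z → G.Reachable r y → (avoid G z).Reachable r y := by
  -- Maximise the component of `r` left by removing `z`. A bare `y` outside it would do better,
  -- since removing `y` leaves that component and also `z` connected to `r`. The condition `v ≠ z`
  -- makes the count zero for `z = r`.
  obtain ⟨z, hz, hmax⟩ := exists_max_image (univ.filter fun z => p z ∧ G.Reachable r z)
    (fun z => (univ.filter fun v => (avoid G z).Reachable r v ∧ v ≠ z).card)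
    ⟨r, by simp [hr]⟩
  simp only [mem_filter, mem_univ, true_and] at hz hmax
  refine ⟨z, hz.1, hz.2, fun y hy hyz hry => ?_⟩
  by_contra hnot
  refine absurd (hmax y ⟨hy, hry⟩) (not_le.2 (card_lt_card ((ssubset_iff_of_subset ?_).2 ⟨z, ?_, ?_⟩)))
  · intro v hv
    simp only [mem_filter, mem_univ, true_and] at hv ⊢
    refine ⟨?_, fun h => hnot (h ▸ hv.1)⟩
    obtain ⟨q⟩ := hv.1
    refine reachable_avoid (q.mapLe (avoid_le z)) fun hyq => hnot ?_
    rw [SimpleGraph.Walk.support_mapLe_eq_support] at hyq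
    exact ⟨q.takeUntil y hyq⟩
  · simp only [mem_filter, mem_univ, true_and]
    refine ⟨?_, hyz.symm⟩
    obtain ⟨q, hq⟩ := hz.2.exists_isPath
    refine reachable_avoid q fun hyq => hnot ?_
    exact reachable_avoid (q.takeUntil y hyq)
      (SimpleGraph.Walk.endpoint_notMem_support_takeUntil hq hyq hyz.symm)
  · simp

/-- A graph with a bare vertex is reducible if its special cycles contain no bare vertices. -/
lemma IsCapSet.reducible_of_bare {C : Finset V} (hC : IsCapSet G C) (hG : EdgeCactus G)
    (hsimp : ∀ v, (∀ a b, G.Adj v a → G.Adj v b → a ≠ b → G.Adj a b) → v ∈ C ∨ Capped G C v)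
    (hS : ∀ E, CycleEdges G E → SpecialEdges G E → ∃ e ∈ E, ∃ c ∈ C, c ∈ e)
    (hS' : ∀ E, CycleEdges G E → SpecialEdges G E → ∀ e ∈ E, ∀ v ∈ e, v ∈ C ∨ Capped G C v)
    {r : V} (hr : r ∉ C ∧ ¬ Capped G C r) : Reducible G := by
  obtain ⟨z, ⟨hzC, hzcap⟩, hrz, hz⟩ := exists_extremal_bare (G := G)
    (p := fun v => v ∉ C ∧ ¬ Capped G C v) hr
  have hnbC : ∀ y, G.Adj z y → y ∉ C := fun y hy hyC => hzcap ⟨y, hyC, hy⟩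
  have hcapped : ∀ y, G.Adj z y → ¬ (avoid G z).Reachable r y → Capped G C y := by
    intro y hzy hry
    by_contra hy
    exact hry (hz y ⟨hnbC y hzy, hy⟩ hzy.ne' (hrz.trans hzy.reachable))
  have hord : ∀ {q : G.Walk z z}, q.IsCycle → ¬ SpecialEdges G q.edgeSet := by
    intro q hq hs
    obtain ⟨e, he, hze⟩ := (mem_support_iff_of_isCycle hq z).1 q.start_mem_support
    rcases hS' _ ⟨z, q, hq, rfl⟩ hs e he z hze with h | h
    · exact hzC h
    · exact hzcap h
  -- With two neighbours of `z` on the side of `r`, the cactus property excludes a third, so all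
  -- others are capped.
  by_cases htwo : ∃ u u', u ≠ u' ∧ G.Adj z u ∧ G.Adj z u' ∧
      (avoid G z).Reachable r u ∧ (avoid G z).Reachable r u'
  · obtain ⟨u, u', hne, hu, hu', hru, hru'⟩ := htwo
    obtain ⟨q, hq, hqu, -, -⟩ :=
      exists_cycle_of_reachable_avoid hu hu' hne (hru.symm.trans hru')
    refine reducible_of_cycle_edge ⟨z, q, hq, rfl⟩ (hord hq) hqu
      (hC.dom_deleteEdges_singleton (u' := u') (fun y hy hyu hyu' => hcapped y hy fun hry => ?_) hu)
    rcases hG.eq_or_eq_of_reachable_avoid hu hu' hy hne (hru.symm.trans hru')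
      (hru.symm.trans hry) with h | h
    · exact hyu h
    · exact hyu' h
  have hone : ∀ u u', G.Adj z u → G.Adj z u' → (avoid G z).Reachable r u →
      (avoid G z).Reachable r u' → u = u' := by
    intro u u' hu hu' hru hru'
    by_contra hne
    exact htwo ⟨u, u', hne, hu, hu', hru, hru'⟩
  by_cases hcyc : ∃ u u', u ≠ u' ∧ G.Adj z u ∧ G.Adj z u' ∧ (avoid G z).Reachable u u'
  · obtain ⟨u, u', hne, hu, hu', huu'⟩ := hcyc
    obtain ⟨q, hq, hqu, -, -⟩ := exists_cycle_of_reachable_avoid hu hu' hne huu'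
    obtain ⟨t, ht⟩ : ∃ t, ∀ y, G.Adj z y → (avoid G z).Reachable r y → y = t := by
      by_cases h : ∃ t, G.Adj z t ∧ (avoid G z).Reachable r t
      · obtain ⟨t, ht, hrt⟩ := h
        exact ⟨t, fun y hy hry => hone y t hy ht hry hrt⟩
      -- No neighbour lies on the side of `r`, so `z` is only a dummy value.
      · exact ⟨z, fun y hy hry => (h ⟨y, hy, hry⟩).elim⟩
    exact reducible_of_cycle_edge ⟨z, q, hq, rfl⟩ (hord hq) hqu
      (hC.dom_deleteEdges_singleton (u' := t)
        (fun y hy _ hyt => hcapped y hy fun hry => hyt (ht y hy hry)) hu)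
  have hdist : ∀ u u', G.Adj z u → G.Adj z u' → (avoid G z).Reachable u u' → u = u' := by
    intro u u' hu hu' huu'
    by_contra hne
    exact hcyc ⟨u, u', hne, hu, hu', huu'⟩
  -- If all neighbours of `z` were on the side of `r`, there would be at most one, and `z` could not
  -- be bare.
  obtain ⟨x, hzx, hrx⟩ : ∃ x, G.Adj z x ∧ ¬ (avoid G z).Reachable r x := by
    by_contra! h
    rcases hsimp z fun a b ha hb hab => (hab (hone a b ha hb (h a ha) (h b hb))).elim with h | h
    · exact hzC h
    · exact hzcap h
  set W : Finset V := univ.filter fun v => (avoid G z).Reachable x v with hWdef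
  have hmemW : ∀ v, v ∈ W ↔ (avoid G z).Reachable x v := by simp [hWdef]
  have hzW : z ∉ W := by
    intro h
    obtain ⟨q, -, hq⟩ := exists_path_of_reachable_avoid ((hmemW z).1 h) hzx.ne'
    exact hq q.end_mem_support
  have hstep : ∀ v ∈ W, ∀ y, G.Adj v y → y ≠ z → y ∈ W := by
    intro v hv y hvy hyz
    have hvz : z ≠ v := fun h => hzW (h ▸ hv)
    exact (hmemW y).2 (((hmemW v).1 hv).trans (avoid_adj.2 ⟨hvy, hvz, hyz.symm⟩).reachable)
  have hexit : ∀ v ∈ W, ∀ y ∉ W, G.Adj v y → y = z := by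
    intro v hv y hy hvy
    by_contra hyz
    exact hy (hstep v hv y hvy hyz)
  have hW : IsCluster G C W x := by
    refine ⟨(hmemW x).2 (SimpleGraph.Reachable.refl _), hnbC x hzx, fun v hv y hy hvy => ?_,
      fun y hy y' hy' hxy hxy' => ?_, fun v hv hvC => ?_⟩
    · obtain rfl := hexit v hv y hy hvy
      exact ⟨(hdist x v hzx hvy.symm ((hmemW v).1 hv)).symm, hzC⟩
    · have hx := (hmemW x).2 (SimpleGraph.Reachable.refl _)
      rw [hexit x hx y hy hxy, hexit x hx y' hy' hxy']
    · by_contra hvcap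
      have hxv := (hmemW v).1 hv
      have hrv := hz v ⟨hvC, hvcap⟩ (fun h => hzW (h ▸ hv))
        ((hrz.trans hzx.reachable).trans (hxv.mono (avoid_le z)))
      exact hrx (hrv.trans hxv.symm)
  rcases hW.reducible_or hC hS with h | hcore
  · exact h
  -- All vertices of `W` other than `x` are caps, so `W` is a star hanging on `z`.
  obtain ⟨l, hlC, hxl⟩ := hW.capped x hW.mem hW.notMem
  refine hC.reducible_of_pendant_star (z := z) hxl (fun h : l = z => hzC (h ▸ hlC)) hzx.symm ?_
    (Y := univ.filter fun u => G.Adj z u ∧ (avoid G z).Reachable r u) ?_ ?_ ?_ ?_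
  · intro y hxy hyz w hyw
    have hyW := hstep x hW.mem y hxy hyz
    have hyC : y ∈ C := by
      by_contra hyC
      exact hxy.ne (hcore y hyW hyC).symm
    have hwz : w ≠ z := by
      rintro rfl
      exact hzcap ⟨y, hyC, hyw.symm⟩
    exact hcore w (hstep y hyW w hyw hwz) fun hwC => hC.indep y hyC w hwC hyw
  · refine card_le_one.2 fun a ha b hb => ?_
    simp only [mem_filter, mem_univ, true_and] at ha hb
    exact hone a b ha.1 hb.1 ha.2 hb.2
  · intro u hu
    exact (mem_filter.1 hu).2.1
  · intro h
    exact hrx (mem_filter.1 h).2.2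
  · intro y hzy _ hy
    exact hcapped y hzy fun hry => hy (mem_filter.2 ⟨mem_univ _, hzy, hry⟩)

lemma EdgeCactus.reducible (hG : EdgeCactus G) (hne : G.edgeSet.Nonempty) : Reducible G := by
  by_cases hlong : ∃ m c, IsThread G m c ∧ 1 ≤ m
  · obtain ⟨m, c, hc, hm⟩ := hlong
    exact hc.reducible hm
  obtain ⟨C, hC, hsimp⟩ := exists_isCapSet G
  have hspec : ∀ E, SpecialEdges G E → ∃ x ∈ C, (∃ e ∈ E, x ∈ e) ∧
      ∀ v, (∃ e ∈ E, v ∈ e) → v = x ∨ G.Adj v x := by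
    intro E hE
    obtain ⟨m, c, hc, hmem⟩ := hE.exists_isThread
    obtain rfl : m = 0 := by
      by_contra hm
      exact hlong ⟨m, c, hc, by omega⟩
    obtain ⟨x, hxC, hx, hadj⟩ := hc.exists_cap hsimp
    exact ⟨x, hxC, (hmem x).2 hx, fun v hv => hadj v ((hmem v).1 hv)⟩
  have hS : ∀ E, CycleEdges G E → SpecialEdges G E → ∃ e ∈ E, ∃ c ∈ C, c ∈ e := by
    intro E _ hE
    obtain ⟨x, hxC, ⟨e, he, hxe⟩, -⟩ := hspec E hE
    exact ⟨e, he, x, hxC, hxe⟩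
  by_cases hbare : ∃ r, r ∉ C ∧ ¬ Capped G C r
  · obtain ⟨r, hr⟩ := hbare
    refine hC.reducible_of_bare hG hsimp hS (fun E _ hE e he v hv => ?_) hr
    obtain ⟨x, hxC, -, hadj⟩ := hspec E hE
    rcases hadj v ⟨e, he, hv⟩ with rfl | h
    · exact Or.inl hxC
    · exact Or.inr ⟨x, hxC, h⟩
  · refine hC.reducible_of_forall_capped hS (fun v hv => ?_) hne
    by_contra h
    exact hbare ⟨v, hv, h⟩

end Main

end CactusGraph

namespace CactusGraph

/-! ### From cycle subgraphs to edge sets -/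

section Counting

variable {V : Type*} {G : SimpleGraph V}

lemma IsCactus.edgeCactus (hG : IsCactus G) : EdgeCactus G := by
  intro v w p q hp hq hpq a b ha hb ha' hb'
  refine hG p.toSubgraph q.toSubgraph ⟨v, p, hp, rfl⟩ ⟨w, q, hq, rfl⟩ ?_ ?_ ?_
  · intro h
    exact hpq (by rw [← p.edgeSet_toSubgraph, h, q.edgeSet_toSubgraph])
  · simp [ha, ha']
  · simp [hb, hb']

/-- Every ordinary edge set is the edge set of a cycle subgraph that is not special. -/
lemma ordinaryCount_add_le [Fintype V] [DecidableRel G.Adj] :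
    ordinaryCount G + {C : G.Subgraph | IsSpecialCycle G C}.ncard ≤
      {C : G.Subgraph | IsCycleSubgraph G C}.ncard := by
  have hsub : {C : G.Subgraph | IsSpecialCycle G C} ⊆ {C | IsCycleSubgraph G C} := by
    rintro C ⟨⟨v, p, hp, hC, -⟩, -⟩
    exact ⟨v, p, hp, hC⟩
  have hle : ordinaryCount G ≤
      ({C : G.Subgraph | IsCycleSubgraph G C} \ {C | IsSpecialCycle G C}).ncard := by
    refine le_trans (Set.ncard_le_ncard ?_ (Set.toFinite _))
      (Set.ncard_image_le (f := SimpleGraph.Subgraph.edgeSet) (Set.toFinite _))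
    rintro E ⟨⟨v, p, hp, rfl⟩, hs⟩
    refine ⟨p.toSubgraph, ⟨⟨v, p, hp, rfl⟩, ?_⟩, p.edgeSet_toSubgraph⟩
    rintro ⟨⟨w, q, hq, hqp, h3⟩, a, b, hab, hdeg⟩
    refine hs ⟨w, q, hq, ?_, h3, a, b, ?_, ?_⟩
    · rw [← q.edgeSet_toSubgraph, hqp, p.edgeSet_toSubgraph]
    · rw [← p.edgeSet_toSubgraph]
      exact hab
    · intro x hx hxa hxb
      have := hdeg x (by rw [← hqp]; simpa using hx) hxa hxb
      rw [← this, ← SimpleGraph.card_neighborSet_eq_degree, Set.ncard_eq_toFinset_card',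
        Set.toFinset_card]
  rw [← Set.ncard_sdiff_add_ncard_of_subset hsub (Set.toFinite _)]
  omega

end Counting

end CactusGraph

/-- Having `k` on the left avoids truncated subtraction in `ℕ∞`. -/
theorem corollary4p1 (K : Type*) [Field K] {V : Type*} [Fintype V]
    (G : SimpleGraph V) [DecidableRel G.Adj] (hG : CactusGraph.IsCactus G) (n k : ℕ)
    (hn : {C : G.Subgraph | CactusGraph.IsCycleSubgraph G C}.ncard = n)
    (hk : {C : G.Subgraph | CactusGraph.IsSpecialCycle G C}.ncard = k) :
    CactusGraph.ara (CactusGraph.edgeIdeal K G) + (k : ℕ∞) ≤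
      CactusGraph.bight (CactusGraph.edgeIdeal K G) + (n : ℕ∞) := by
  have hcut : CactusGraph.CutBy (CactusGraph.edgeIdeal K G)
      (CactusGraph.dom G + CactusGraph.ordinaryCount G) :=
    CactusGraph.cutBy_of_forall_reducible (p := CactusGraph.EdgeCactus)
      (fun _ _ hle h => h.mono hle) (fun H hH hne => CactusGraph.EdgeCactus.reducible hH hne) G
      hG.edgeCactus
  have hcount := CactusGraph.ordinaryCount_add_le (G := G)
  rw [hn, hk] at hcount
  calc CactusGraph.ara (CactusGraph.edgeIdeal K G) + (k : ℕ∞)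
      ≤ ((CactusGraph.dom G + CactusGraph.ordinaryCount G : ℕ) : ℕ∞) + k :=
        add_le_add_left hcut.ara_le _
    _ = CactusGraph.dom G + ((CactusGraph.ordinaryCount G + k : ℕ) : ℕ∞) := by
        push_cast; rw [add_assoc]
    _ ≤ CactusGraph.bight (CactusGraph.edgeIdeal K G) + (n : ℕ∞) :=
        add_le_add CactusGraph.dom_le_bight (by exact_mod_cast hcount)
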